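/- Let $n\ge 0$, $1<p<\infty$, $\frac1p+\frac1{p'}=1$. Let $\mathcal S(\mathbb Z^n)$ be the space of rapidly decreasing functions on $\mathbb Z^n$ and $\mathcal S(\mathbb Z^n\times\mathbb T^n)$ the space of functions $\varphi(k,x)$ that are smooth in $x\in\mathbb T^n=(\mathbb R/\mathbb Z)^n$ and all of whose $x$-derivatives decrease rapidly in $k\in\mathbb Z^n$ (uniformly in $x$), with the usual seminorms; $\mathcal S'$ denotes the space of continuous linear functionals (tempered distributions), and $dw$ is normalised Haar measure on $\mathbb T^n$. For $m\in\mathbb Z^n$, $w\in\mathbb T^n$ put $(M_wT_mg)(k)=e^{2\pi i w\cdot k}g(k-m)$ and $$V_gf(m,w)=\langle f,M_wT_mg\rangle=\sum_{k\in\mathbb Z^n}f(k)\,\overline{g(k-m)}\,e^{-2\pi i w\cdot k}.$$ Fix a non-zero window $\gamma\in\mathcal S(\mathbb Z^n)$. For $1\le r\le\infty$ the modulation space $M^r(\mathbb Z^n)$ consists of all $f\in\mathcal S'(\mathbb Z^n)$ with $\|f\|_{M^r}:=\|V_\gamma f\|_{L^r(\mathbb Z^n\times\mathbb T^n)}<\infty$.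 Likewise, for a fixed non-zero window $\Gamma\in\mathcal S(\mathbb Z^n\times\mathbb T^n)$, $M^1(\mathbb Z^n\times\mathbb T^n)$ consists of all $\varsigma\in\mathcal S'(\mathbb Z^n\times\mathbb T^n)$ whose short-time Fourier transform $$V_\Gamma\varsigma(m,w,\xi,l)=\big\langle\varsigma,\;e^{2\pi i(\xi\cdot k+l\cdot x)}\,\Gamma(k-m,x-w)\big\rangle_{(k,x)}$$ is integrable over $(m,w,\xi,l)\in\mathbb Z^n\times\mathbb T^n\times\mathbb T^n\times\mathbb Z^n$. **Theorem.** Let $\varsigma\in M^1(\mathbb Z^n\times\mathbb T^n)$, $g_1\in M^{p'}(\mathbb Z^n)$ and $g_2\in M^p(\mathbb Z^n)$. Then $\varsigma$ is (given by) a function in $L^1(\mathbb Z^n\times\mathbb T^n)$, and the localization operator $$\mathfrak L^{g_1,g_2}_{\varsigma}f(k)=\sum_{m\in\mathbb Z^n}\int_{\mathbb T^n}\varsigma(m,w)\,V_{g_1}f(m,w)\,(M_wT_mg_2)(k)\,dw,\qquad k\in\mathbb Z^n,$$ is well defined on $M^p(\mathbb Z^n)$ (the series for $V_{g_1}f$ and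 the sum-integral converge absolutely for all $f\in M^p(\mathbb Z^n)$) and is a compact bounded linear operator $M^p(\mathbb Z^n)\to M^p(\mathbb Z^n)$. -/

import Mathlib

open MeasureTheory
open scoped ENNReal ContDiff ComplexConjugate Topology

noncomputable section

namespace DiscreteTF

/-- The lattice `ℤⁿ` (`‖k‖ = max |kᵢ|`; any other norm gives the same Schwartz space). -/
abbrev IntLattice (n : ℕ) : Type := Fin n → ℤ

/-- The torus `𝕋ⁿ = (ℝ/ℤ)ⁿ`. The character `x ↦ e^{2πi k·x}` is `UnitAddTorus.mFourier k`. -/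
abbrev Torus (n : ℕ) : Type := UnitAddTorus (Fin n)

/-- Normalised Haar measure `dw` on `𝕋ⁿ`. -/
def haarTorus (n : ℕ) : Measure (Torus n) :=
  Measure.pi fun _ => (AddCircle.haarAddCircle : Measure UnitAddCircle)

/-- The measure "counting × Haar" on `ℤⁿ × 𝕋ⁿ`. -/
def phaseMeasure (n : ℕ) : Measure (IntLattice n × Torus n) :=
  (Measure.count : Measure (IntLattice n)).prod (haarTorus n)

theorem one_add_norm_le {n : ℕ} (k m : IntLattice n) :
    1 + ‖k‖ ≤ (1 + ‖m‖) * (1 + ‖k - m‖) := by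
  have h : ‖k‖ ≤ ‖k - m‖ + ‖m‖ := by simpa using norm_add_le (k - m) m
  nlinarith [norm_nonneg m, norm_nonneg (k - m)]

theorem norm_mFourier_apply {n : ℕ} (k : IntLattice n) (w : Torus n) :
    ‖UnitAddTorus.mFourier k w‖ = 1 := by
  simp only [UnitAddTorus.mFourier, ContinuousMap.coe_mk, norm_prod, fourier_apply,
    Circle.norm_coe, Finset.prod_const_one]

/-! ### Schwartz functions and tempered distributions on `ℤⁿ` -/

/-- The rapidly decreasing functions on `ℤⁿ`, as a subspace of all functions. -/
def schwartzZ (n : ℕ) : Submodule ℂ (IntLattice n → ℂ) where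
  carrier := {g | ∀ j : ℕ, ∃ C : ℝ, ∀ k, (1 + ‖k‖) ^ j * ‖g k‖ ≤ C}
  add_mem' := by
    intro f g hf hg j
    obtain ⟨C, hC⟩ := hf j
    obtain ⟨D, hD⟩ := hg j
    refine ⟨C + D, fun k => ?_⟩
    calc (1 + ‖k‖) ^ j * ‖f k + g k‖ ≤ (1 + ‖k‖) ^ j * (‖f k‖ + ‖g k‖) := by
          gcongr; exact norm_add_le _ _
      _ ≤ C + D := by rw [mul_add]; exact add_le_add (hC k) (hD k)
  zero_mem' := fun j => ⟨0, fun k => by simp⟩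
  smul_mem' := by
    intro c f hf j
    obtain ⟨C, hC⟩ := hf j
    refine ⟨‖c‖ * C, fun k => ?_⟩
    calc (1 + ‖k‖) ^ j * ‖c * f k‖ = ‖c‖ * ((1 + ‖k‖) ^ j * ‖f k‖) := by
          rw [norm_mul]; ring
      _ ≤ ‖c‖ * C := by gcongr; exact hC k

/-- The Schwartz space `𝒮(ℤⁿ)`. -/
def SchwartzZ (n : ℕ) : Type := ↥(schwartzZ n)

namespace SchwartzZ

variable {n : ℕ}

instance : AddCommGroup (SchwartzZ n) := inferInstanceAs (AddCommGroup ↥(schwartzZ n))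

instance : Module ℂ (SchwartzZ n) := inferInstanceAs (Module ℂ ↥(schwartzZ n))

/-- The function underlying an element of `𝒮(ℤⁿ)`. -/
def toFun (g : SchwartzZ n) : IntLattice n → ℂ := g.1

instance : CoeFun (SchwartzZ n) (fun _ => IntLattice n → ℂ) := ⟨toFun⟩

theorem decay (g : SchwartzZ n) (j : ℕ) : ∃ C : ℝ, ∀ k, (1 + ‖k‖) ^ j * ‖g k‖ ≤ C := g.2 j

theorem bddAbove (g : SchwartzZ n) (j : ℕ) :
    BddAbove (Set.range fun k : IntLattice n => (1 + ‖k‖) ^ j * ‖g k‖) := by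
  obtain ⟨C, hC⟩ := g.decay j
  exact ⟨C, by rintro _ ⟨k, rfl⟩; exact hC k⟩

/-- The seminorm `p_j(g) = sup_k (1 + |k|)^j |g(k)|`. -/
def seminorm (n : ℕ) (j : ℕ) : Seminorm ℂ (SchwartzZ n) :=
  Seminorm.of (fun g => ⨆ k : IntLattice n, (1 + ‖k‖) ^ j * ‖g k‖)
    (by
      intro f g
      refine ciSup_le fun k => ?_
      calc (1 + ‖k‖) ^ j * ‖f k + g k‖ ≤ (1 + ‖k‖) ^ j * (‖f k‖ + ‖g k‖) := by
            gcongr; exact norm_add_le _ _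
        _ ≤ _ := by
            rw [mul_add]
            exact add_le_add (le_ciSup (f.bddAbove j) k) (le_ciSup (g.bddAbove j) k))
    (by
      intro c f
      rw [Real.mul_iSup_of_nonneg (norm_nonneg c)]
      refine iSup_congr fun k => ?_
      change (1 + ‖k‖) ^ j * ‖c * f k‖ = _
      rw [norm_mul]; ring)

/-- The locally convex topology of `𝒮(ℤⁿ)` generated by the seminorms `p_j`. -/
instance : TopologicalSpace (SchwartzZ n) :=
  (show SeminormFamily ℂ (SchwartzZ n) ℕ from seminorm n).moduleFilterBasis.topology

/-- The function `δ_k ∈ 𝒮(ℤⁿ)`. -/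
def delta (k : IntLattice n) : SchwartzZ n :=
  ⟨Pi.single k 1, fun j => ⟨(1 + ‖k‖) ^ j, fun m => by
    by_cases h : m = k
    · subst h; simp
    · simp only [Pi.single_apply, if_neg h, norm_zero, mul_zero]; positivity⟩⟩

/-- The Schwartz function `k ↦ conj ((M_w T_m g)(k)) = conj (e^{2πi w·k} g(k - m))`. -/
def conjShift (g : SchwartzZ n) (m : IntLattice n) (w : Torus n) : SchwartzZ n :=
  ⟨fun k => conj (UnitAddTorus.mFourier k w * g (k - m)), fun j => by
    obtain ⟨C, hC⟩ := g.decay j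
    refine ⟨(1 + ‖m‖) ^ j * C, fun k => ?_⟩
    rw [RCLike.norm_conj, norm_mul, norm_mFourier_apply, one_mul]
    calc (1 + ‖k‖) ^ j * ‖g (k - m)‖
        ≤ ((1 + ‖m‖) * (1 + ‖k - m‖)) ^ j * ‖g (k - m)‖ := by
          gcongr; exact one_add_norm_le k m
      _ = (1 + ‖m‖) ^ j * ((1 + ‖k - m‖) ^ j * ‖g (k - m)‖) := by rw [mul_pow]; ring
      _ ≤ (1 + ‖m‖) ^ j * C := by gcongr; exact hC _⟩

end SchwartzZ

/-- The tempered distributions `𝒮'(ℤⁿ)`. -/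
abbrev TemperedZ (n : ℕ) : Type := SchwartzZ n →L[ℂ] ℂ

/-- The value `f(k)` of a tempered distribution on `ℤⁿ` at `k`, that is, its value on `δ_k`. -/
def TemperedZ.coeff {n : ℕ} (f : TemperedZ n) (k : IntLattice n) : ℂ := f (SchwartzZ.delta k)

/-- The tempered distribution `f` is (given by) the function `u` on `ℤⁿ`. -/
def TemperedZ.IsFunction {n : ℕ} (f : TemperedZ n) (u : IntLattice n → ℂ) : Prop :=
  ∀ φ : SchwartzZ n, HasSum (fun k => u k * φ k) (f φ)

/-- The short-time Fourier transform `V_g f (m, w) = ⟨f, M_w T_m g⟩` of `f ∈ 𝒮'(ℤⁿ)` with respect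
to a window `g ∈ 𝒮(ℤⁿ)`. -/
def stftZ {n : ℕ} (g : SchwartzZ n) (f : TemperedZ n) (z : IntLattice n × Torus n) : ℂ :=
  f (g.conjShift z.1 z.2)

/-- The modulation space `M^p(ℤⁿ)` (with respect to the window `γ`) as a subspace of `𝒮'(ℤⁿ)`. -/
def modulationZ {n : ℕ} (γ : SchwartzZ n) (p : ℝ≥0∞) : Submodule ℂ (TemperedZ n) where
  carrier := {f | MemLp (stftZ γ f) p (phaseMeasure n)}
  add_mem' := fun hf hg => hf.add hg
  zero_mem' := by
    change MemLp (fun _ => (0 : ℂ)) p _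
    exact MemLp.zero
  smul_mem' := fun c _ hf => hf.const_smul c

/-- The modulation space `M^p(ℤⁿ)`, normed by `‖f‖ = ‖V_γ f‖_{L^p(ℤⁿ × 𝕋ⁿ)}`. -/
def ModulationZ {n : ℕ} (γ : SchwartzZ n) (p : ℝ≥0∞) : Type := ↥(modulationZ γ p)

namespace ModulationZ

variable {n : ℕ} {γ : SchwartzZ n} {p : ℝ≥0∞}

instance : AddCommGroup (ModulationZ γ p) := inferInstanceAs (AddCommGroup ↥(modulationZ γ p))

instance : Module ℂ (ModulationZ γ p) := inferInstanceAs (Module ℂ ↥(modulationZ γ p))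

/-- The tempered distribution underlying an element of `M^p(ℤⁿ)`. -/
def toTempered (f : ModulationZ γ p) : TemperedZ n := f.1

/-- The linear map `f ↦ V_γ f` from `M^p(ℤⁿ)` to `L^p(ℤⁿ × 𝕋ⁿ)`. -/
def toLp : ModulationZ γ p →ₗ[ℂ] Lp ℂ p (phaseMeasure n) where
  toFun f := MemLp.toLp (stftZ γ f.toTempered) f.2
  map_add' _ _ := rfl
  map_smul' _ _ := rfl

instance [Fact (1 ≤ p)] : SeminormedAddCommGroup (ModulationZ γ p) :=
  SeminormedAddCommGroup.induced _ (Lp ℂ p (phaseMeasure n)) toLp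

theorem norm_def [Fact (1 ≤ p)] (f : ModulationZ γ p) :
    ‖f‖ = (eLpNorm (stftZ γ f.toTempered) p (phaseMeasure n)).toReal :=
  Lp.norm_toLp (stftZ γ f.toTempered) f.2

end ModulationZ

/-! ### Schwartz functions and tempered distributions on `ℤⁿ × 𝕋ⁿ` -/

/-- A function on `𝕋ⁿ`, viewed as a `ℤⁿ`-periodic function on `ℝⁿ`. -/
def lift {n : ℕ} (f : Torus n → ℂ) : (Fin n → ℝ) → ℂ := fun x => f fun i => (x i : UnitAddCircle)

/-- All derivatives of a smooth function on the torus are bounded. -/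
theorem lift_bounded {n : ℕ} (f : Torus n → ℂ) (hf : ContDiff ℝ ∞ (lift f)) (l : ℕ) :
    ∃ C : ℝ, ∀ x, ‖iteratedFDeriv ℝ l (lift f) x‖ ≤ C := by
  have hcont : Continuous fun x => ‖iteratedFDeriv ℝ l (lift f) x‖ :=
    (hf.continuous_iteratedFDeriv (m := l) (by exact_mod_cast le_top)).norm
  obtain ⟨C, hC⟩ := (isCompact_univ_pi fun _ : Fin n =>
    isCompact_Icc (a := (0 : ℝ)) (b := 1)).bddAbove_image hcont.continuousOn
  refine ⟨C, fun x => ?_⟩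
  let z : Fin n → ℝ := fun i => (⌊x i⌋ : ℝ)
  have hper : (fun y => lift f (y + z)) = lift f := by
    funext y
    refine congrArg f (funext fun i => ?_)
    simp [z]
  have h1 := iteratedFDeriv_comp_add_right (𝕜 := ℝ) (f := lift f) l z (fun i => Int.fract (x i))
  rw [hper] at h1
  have h2 : (fun i => Int.fract (x i)) + z = x := by
    funext i; simp [z, Int.fract_add_floor]
  rw [h2] at h1
  rw [← h1]
  refine hC ⟨_, fun i _ => ⟨Int.fract_nonneg _, (Int.fract_lt_one _).le⟩, rfl⟩

/-- The smooth functions `φ(k, x)` on `ℤⁿ × 𝕋ⁿ` all of whose `x`-derivatives decrease rapidly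
in `k`. -/
def schwartzZT (n : ℕ) : Submodule ℂ (IntLattice n → Torus n → ℂ) where
  carrier := {φ | (∀ k, ContDiff ℝ ∞ (lift (φ k))) ∧ ∀ j l : ℕ, ∃ C : ℝ, ∀ k x,
    (1 + ‖k‖) ^ j * ‖iteratedFDeriv ℝ l (lift (φ k)) x‖ ≤ C}
  add_mem' := by
    intro f g hf hg
    refine ⟨fun k => (hf.1 k).add (hg.1 k), fun j l => ?_⟩
    obtain ⟨C, hC⟩ := hf.2 j l
    obtain ⟨D, hD⟩ := hg.2 j l
    refine ⟨C + D, fun k x => ?_⟩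
    have h : iteratedFDeriv ℝ l (lift ((f + g) k)) x
        = iteratedFDeriv ℝ l (lift (f k)) x + iteratedFDeriv ℝ l (lift (g k)) x :=
      iteratedFDeriv_add_apply ((hf.1 k).of_le (by exact_mod_cast le_top)).contDiffAt
        ((hg.1 k).of_le (by exact_mod_cast le_top)).contDiffAt
    rw [h]
    calc _ ≤ (1 + ‖k‖) ^ j * (‖iteratedFDeriv ℝ l (lift (f k)) x‖
            + ‖iteratedFDeriv ℝ l (lift (g k)) x‖) := by gcongr; exact norm_add_le _ _
      _ ≤ C + D := by rw [mul_add]; exact add_le_add (hC k x) (hD k x)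
  zero_mem' := by
    have h (k : IntLattice n) : lift ((0 : IntLattice n → Torus n → ℂ) k) = 0 := rfl
    refine ⟨fun k => by rw [h]; exact contDiff_const, fun j l => ⟨0, fun k x => ?_⟩⟩
    rw [h, iteratedFDeriv_zero]; simp
  smul_mem' := by
    intro c f hf
    refine ⟨fun k => (hf.1 k).const_smul c, fun j l => ?_⟩
    obtain ⟨C, hC⟩ := hf.2 j l
    refine ⟨‖c‖ * C, fun k x => ?_⟩
    have h : iteratedFDeriv ℝ l (lift ((c • f) k)) x = c • iteratedFDeriv ℝ l (lift (f k)) x := by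
      rw [show lift ((c • f) k) = c • lift (f k) from rfl]
      exact iteratedFDeriv_const_smul_apply
        ((hf.1 k).of_le (by exact_mod_cast le_top)).contDiffAt
    rw [h, norm_smul]
    calc _ = ‖c‖ * ((1 + ‖k‖) ^ j * ‖iteratedFDeriv ℝ l (lift (f k)) x‖) := by ring
      _ ≤ ‖c‖ * C := by gcongr; exact hC k x

/-- The Schwartz space `𝒮(ℤⁿ × 𝕋ⁿ)`. -/
def SchwartzZT (n : ℕ) : Type := ↥(schwartzZT n)

namespace SchwartzZT

variable {n : ℕ}

instance : AddCommGroup (SchwartzZT n) := inferInstanceAs (AddCommGroup ↥(schwartzZT n))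

instance : Module ℂ (SchwartzZT n) := inferInstanceAs (Module ℂ ↥(schwartzZT n))

/-- The function underlying an element of `𝒮(ℤⁿ × 𝕋ⁿ)`. -/
def toFun (φ : SchwartzZT n) : IntLattice n → Torus n → ℂ := φ.1

instance : CoeFun (SchwartzZT n) (fun _ => IntLattice n → Torus n → ℂ) := ⟨toFun⟩

theorem smooth (φ : SchwartzZT n) (k : IntLattice n) : ContDiff ℝ ∞ (lift (φ k)) := φ.2.1 k

theorem decay (φ : SchwartzZT n) (j l : ℕ) : ∃ C : ℝ, ∀ k x,
    (1 + ‖k‖) ^ j * ‖iteratedFDeriv ℝ l (lift (φ k)) x‖ ≤ C := φ.2.2 j l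

theorem bddAbove (φ : SchwartzZT n) (j l : ℕ) :
    BddAbove (Set.range fun z : IntLattice n × (Fin n → ℝ) =>
      (1 + ‖z.1‖) ^ j * ‖iteratedFDeriv ℝ l (lift (φ z.1)) z.2‖) := by
  obtain ⟨C, hC⟩ := φ.decay j l
  exact ⟨C, by rintro _ ⟨z, rfl⟩; exact hC z.1 z.2⟩

/-- The seminorm `p_{j,l}(φ) = sup_{k,x} (1 + |k|)^j |D_x^l φ(k, x)|`. -/
def seminorm (n : ℕ) (i : ℕ × ℕ) : Seminorm ℂ (SchwartzZT n) :=
  Seminorm.of (fun φ => ⨆ z : IntLattice n × (Fin n → ℝ),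
      (1 + ‖z.1‖) ^ i.1 * ‖iteratedFDeriv ℝ i.2 (lift (φ z.1)) z.2‖)
    (by
      intro f g
      refine ciSup_le fun z => ?_
      have h : iteratedFDeriv ℝ i.2 (lift ((f + g : SchwartzZT n) z.1)) z.2
          = iteratedFDeriv ℝ i.2 (lift (f z.1)) z.2 + iteratedFDeriv ℝ i.2 (lift (g z.1)) z.2 :=
        iteratedFDeriv_add_apply ((f.smooth _).of_le (by exact_mod_cast le_top)).contDiffAt
          ((g.smooth _).of_le (by exact_mod_cast le_top)).contDiffAt
      rw [h]
      calc _ ≤ (1 + ‖z.1‖) ^ i.1 * (‖iteratedFDeriv ℝ i.2 (lift (f z.1)) z.2‖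
              + ‖iteratedFDeriv ℝ i.2 (lift (g z.1)) z.2‖) := by gcongr; exact norm_add_le _ _
        _ ≤ _ := by
            rw [mul_add]
            exact add_le_add (le_ciSup (f.bddAbove i.1 i.2) z) (le_ciSup (g.bddAbove i.1 i.2) z))
    (by
      intro c f
      rw [Real.mul_iSup_of_nonneg (norm_nonneg c)]
      refine iSup_congr fun z => ?_
      have h : iteratedFDeriv ℝ i.2 (lift ((c • f : SchwartzZT n) z.1)) z.2
          = c • iteratedFDeriv ℝ i.2 (lift (f z.1)) z.2 := by
        rw [show lift ((c • f : SchwartzZT n) z.1) = c • lift (f z.1) from rfl]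
        exact iteratedFDeriv_const_smul_apply
          ((f.smooth _).of_le (by exact_mod_cast le_top)).contDiffAt
      rw [h, norm_smul]; ring)

/-- The locally convex topology of `𝒮(ℤⁿ × 𝕋ⁿ)` generated by the seminorms `p_{j,l}`. -/
instance : TopologicalSpace (SchwartzZT n) :=
  (show SeminormFamily ℂ (SchwartzZT n) (ℕ × ℕ) from seminorm n).moduleFilterBasis.topology

theorem contDiff_lift_mFourier (l : IntLattice n) :
    ContDiff ℝ ∞ (lift fun x : Torus n => UnitAddTorus.mFourier l x) := by
  have h : (lift fun x : Torus n => UnitAddTorus.mFourier l x)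
      = fun x => ∏ i, Complex.exp (2 * Real.pi * Complex.I * l i * (x i : ℂ)) := by
    funext x
    simp [lift, UnitAddTorus.mFourier]
  rw [h]
  refine contDiff_prod fun i _ => ContDiff.cexp (contDiff_const.mul ?_)
  exact Complex.ofRealCLM.contDiff.comp (contDiff_apply ℝ ℝ i)

/-- The Schwartz function `(k, x) ↦ conj (e^{2πi (ξ·k + l·x)} Γ(k - m, x - w))`, the conjugate of
the time-frequency shift of `Γ` by `((m, w), (ξ, l))`. -/
def conjShift (Γ : SchwartzZT n) (m : IntLattice n) (w : Torus n) (ξ : Torus n) (l : IntLattice n) :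
    SchwartzZT n :=
  ⟨fun k x => conj (UnitAddTorus.mFourier k ξ * UnitAddTorus.mFourier l x * Γ (k - m) (x - w)), by
    obtain ⟨v, hv⟩ : ∃ v : Fin n → ℝ, ∀ i, (v i : UnitAddCircle) = w i :=
      ⟨fun i => (QuotientAddGroup.mk_surjective (w i)).choose,
        fun i => (QuotientAddGroup.mk_surjective (w i)).choose_spec⟩
    let e : (Fin n → ℝ) → ℂ := lift fun x : Torus n => UnitAddTorus.mFourier l x
    have he : ContDiff ℝ ∞ e := contDiff_lift_mFourier l
    have hsh (k : IntLattice n) : ContDiff ℝ ∞ fun x => lift (Γ (k - m)) (x - v) :=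
      (Γ.smooth (k - m)).comp (contDiff_id.sub contDiff_const)
    have hfun (k : IntLattice n) :
        lift (fun x => conj (UnitAddTorus.mFourier k ξ * UnitAddTorus.mFourier l x
          * Γ (k - m) (x - w)))
        = Complex.conjLIE ∘ (UnitAddTorus.mFourier k ξ •
            fun x => e x * lift (Γ (k - m)) (x - v)) := by
      funext x
      have : (fun i => ((x i : ℝ) : UnitAddCircle)) - w
          = fun i => (((x - v) i : ℝ) : UnitAddCircle) := by
        funext i; simp [hv]
      simp [lift, e, this, mul_assoc]
    have hsm (k : IntLattice n) : ContDiff ℝ ∞ (UnitAddTorus.mFourier k ξ •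
        fun x => e x * lift (Γ (k - m)) (x - v)) :=
      (he.mul (hsh k)).const_smul (UnitAddTorus.mFourier k ξ)
    refine ⟨fun k => ?_, fun j a => ?_⟩
    · rw [hfun]
      exact Complex.conjLIE.contDiff.comp (hsm k)
    · choose E hE using fun b => lift_bounded (fun x : Torus n => UnitAddTorus.mFourier l x) he b
      choose C hC using Γ.decay j
      refine ⟨∑ i ∈ Finset.range (a + 1), (a.choose i : ℝ) * E i * ((1 + ‖m‖) ^ j * C (a - i)),
        fun k x => ?_⟩
      rw [hfun, LinearIsometryEquiv.norm_iteratedFDeriv_comp_left,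
        iteratedFDeriv_const_smul_apply
          (((he.mul (hsh k)).of_le (by exact_mod_cast le_top)).contDiffAt),
        norm_smul, norm_mFourier_apply, one_mul]
      have hb := norm_iteratedFDeriv_mul_le he (hsh k) x (n := a) (by exact_mod_cast le_top)
      refine (mul_le_mul_of_nonneg_left hb (by positivity)).trans ?_
      rw [Finset.mul_sum]
      refine Finset.sum_le_sum fun i _ => ?_
      have h1 : (1 + ‖k‖) ^ j *
          ‖iteratedFDeriv ℝ (a - i) (fun x => lift (Γ (k - m)) (x - v)) x‖
          ≤ (1 + ‖m‖) ^ j * C (a - i) := by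
        rw [iteratedFDeriv_comp_sub]
        calc _ ≤ ((1 + ‖m‖) * (1 + ‖k - m‖)) ^ j *
              ‖iteratedFDeriv ℝ (a - i) (lift (Γ (k - m))) (x - v)‖ := by
              gcongr; exact one_add_norm_le k m
          _ = (1 + ‖m‖) ^ j * ((1 + ‖k - m‖) ^ j *
              ‖iteratedFDeriv ℝ (a - i) (lift (Γ (k - m))) (x - v)‖) := by
              rw [mul_pow]; ring
          _ ≤ _ := by gcongr; exact hC _ _ _
      calc _ = (a.choose i : ℝ) * ‖iteratedFDeriv ℝ i e x‖ * ((1 + ‖k‖) ^ j *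
          ‖iteratedFDeriv ℝ (a - i) (fun x => lift (Γ (k - m)) (x - v)) x‖) := by ring
        _ ≤ _ := by
          have := hE i x
          have hE0 : 0 ≤ E i := (norm_nonneg _).trans this
          gcongr⟩

end SchwartzZT

/-- The tempered distributions `𝒮'(ℤⁿ × 𝕋ⁿ)`. -/
abbrev TemperedZT (n : ℕ) : Type := SchwartzZT n →L[ℂ] ℂ

/-- The short-time Fourier transform on `ℤⁿ × 𝕋ⁿ`: the value of `V_Γ ς` at the point
`((m, w), (ξ, l))` of `(ℤⁿ × 𝕋ⁿ) × (𝕋ⁿ × ℤⁿ)`, the phase space of `ℤⁿ × 𝕋ⁿ`. -/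
def stftZT {n : ℕ} (Γ : SchwartzZT n) (ς : TemperedZT n)
    (z : (IntLattice n × Torus n) × (Torus n × IntLattice n)) : ℂ :=
  ς (Γ.conjShift z.1.1 z.1.2 z.2.1 z.2.2)

/-- `ς` belongs to the modulation space `M^p(ℤⁿ × 𝕋ⁿ)` (with respect to the window `Γ`). -/
def MemModulationZT {n : ℕ} (Γ : SchwartzZT n) (p : ℝ≥0∞) (ς : TemperedZT n) : Prop :=
  MemLp (stftZT Γ ς) p ((phaseMeasure n).prod ((haarTorus n).prod Measure.count))

/-- The tempered distribution `ς` is (given by) the function `F ∈ L¹(ℤⁿ × 𝕋ⁿ)`. -/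
def TemperedZT.IsFunction {n : ℕ} (ς : TemperedZT n) (F : IntLattice n × Torus n → ℂ) : Prop :=
  Integrable F (phaseMeasure n) ∧ ∀ φ : SchwartzZT n, ς φ = ∫ z, F z * φ z.1 z.2 ∂(phaseMeasure n)

/-! ### Localization operators -/

/-- `(M_w T_m g)(k) = e^{2πi w·k} g(k - m)`. -/
def tfShift {n : ℕ} (m : IntLattice n) (w : Torus n) (g : IntLattice n → ℂ) (k : IntLattice n) : ℂ :=
  UnitAddTorus.mFourier k w * g (k - m)

/-- `V_g f (m, w) = ∑_k f(k) conj ((M_w T_m g)(k))` for functions `f`, `g` on `ℤⁿ`. -/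
def stftFun {n : ℕ} (g f : IntLattice n → ℂ) (m : IntLattice n) (w : Torus n) : ℂ :=
  ∑' k, f k * conj (tfShift m w g k)

/-- The integrand `F(m, w) V_{g₁} f(m, w) (M_w T_m g₂)(k)`. -/
def locIntegrand {n : ℕ} (F : IntLattice n × Torus n → ℂ) (g₁ g₂ f : IntLattice n → ℂ) (k : IntLattice n)
    (z : IntLattice n × Torus n) : ℂ :=
  F z * stftFun g₁ f z.1 z.2 * tfShift z.1 z.2 g₂ k

/-- The localization operator with symbol `F` and windows `g₁`, `g₂`:
`L f (k) = ∑_m ∫ F(m, w) V_{g₁} f(m, w) (M_w T_m g₂)(k) dw`. -/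
def locOp {n : ℕ} (F : IntLattice n × Torus n → ℂ) (g₁ g₂ f : IntLattice n → ℂ) (k : IntLattice n) : ℂ :=
  ∑' m, ∫ w, locIntegrand F g₁ g₂ f k (m, w) ∂(haarTorus n)

end DiscreteTF

end

open DiscreteTF

noncomputable section

namespace DiscreteTF

variable {n : ℕ}

/-! The frequency variables dual to ℤⁿ are compact, so local Fourier regularity costs nothing and
modulation spaces become sequence spaces. With the discrete variables fixed, a short-time Fourier
transform is a series of characters in the torus variables, whose coefficients are those of the
distribution times those of the window. Each coefficient is at most the L¹ norm over the torus
(`enorm_coeff_le_lintegral`), and a window that is non-zero somewhere can be divided out.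

On ℤⁿ × 𝕋ⁿ this makes the numbers ς(δ_k ⊗ e_s) absolutely summable
(`MemModulationZT.summable_coeff`). Hence ς is an integrable function, given on each slice by an
absolutely convergent Fourier series. On ℤⁿ it gives M^p = ℓ^p with equivalent norms: Jensen's
inequality yields M^p ⊂ ℓ^p (`tsum_enorm_coeff_rpow_le`), and Young's inequality the converse
(`eLpNorm_stftZ_ellTempered_le`).

On ℓ^p the localization operator is the Bochner integral of F(z) R(z), where R(z) f = V_{g₁}f(z)
M_wT_m g₂ has rank one. Time-frequency shifts are isometries of ℓ^p and ℓ^q, so ‖R(z)‖ is bounded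
uniformly and F ∈ L¹ suffices for integrability. Compact operators form a closed subspace, so the
integral is compact (`isCompactOperator_locEll`). Composition with the two inclusions carries the
result to M^p. -/

instance : IsProbabilityMeasure (haarTorus n) := by unfold haarTorus; infer_instance

instance : (haarTorus n).IsAddHaarMeasure := by unfold haarTorus; infer_instance

instance : SigmaFinite (phaseMeasure n) := by unfold phaseMeasure; infer_instance

/-! ### Lattice sums -/

theorem summable_inv_one_add_norm_pow (n : ℕ) :
    Summable fun k : IntLattice n => ((1 + ‖k‖) ^ (n + 1))⁻¹ := by
  let b := Pi.basisFun ℝ (Fin n)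
  let L : Submodule ℤ (Fin n → ℝ) := Submodule.span ℤ (Set.range b)
  have hr : Module.finrank ℤ L = n := by
    rw [ZLattice.rank ℝ L]; simp
  have h := ZLattice.summable_norm_pow_inv L (n + 1) (by rw [hr]; omega)
  let e : IntLattice n → L := fun k => ⟨fun i => (k i : ℝ), by
    rw [Module.Basis.mem_span_iff_repr_mem]
    intro i; exact ⟨k i, by simp [b]⟩⟩
  have he : Function.Injective e := by
    intro k m hkm
    funext i
    have := congrFun (congrArg Subtype.val hkm) i
    simpa [e] using this
  have hn (k : IntLattice n) : ‖e k‖ = ‖k‖ := by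
    change ‖(fun i => (k i : ℝ))‖ = ‖k‖
    simp [Pi.norm_def]
    congr
  have h2 := h.comp_injective he
  -- At k = 0 the comparison fails, since ‖0‖⁻¹ = 0 by convention; the origin is discarded.
  refine Summable.of_norm_bounded_eventually h2 ?_
  have : ({0} : Set (IntLattice n)).Finite := Set.finite_singleton 0
  filter_upwards [this.compl_mem_cofinite] with k hk
  have hk' : 0 < ‖k‖ := norm_pos_iff.2 hk
  rw [Real.norm_of_nonneg (by positivity)]
  simp only [Function.comp, hn]
  rw [← inv_pow]; gcongr; linarith

/-! ### Characters -/

theorem mFourier_apply_add (k : IntLattice n) (x y : Torus n) :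
    UnitAddTorus.mFourier k (x + y) = UnitAddTorus.mFourier k x * UnitAddTorus.mFourier k y := by
  simp [UnitAddTorus.mFourier, fourier_apply, smul_add, AddCircle.toCircle_add,
    Finset.prod_mul_distrib]

theorem mFourier_apply_neg (k : IntLattice n) (x : Torus n) :
    UnitAddTorus.mFourier k (-x) = UnitAddTorus.mFourier (-k) x := by
  simp [UnitAddTorus.mFourier, fourier_apply]

theorem mFourier_neg_mul_self (k : IntLattice n) (x : Torus n) :
    UnitAddTorus.mFourier (-k) x * UnitAddTorus.mFourier k x = 1 := by
  rw [← UnitAddTorus.mFourier_add, neg_add_cancel, UnitAddTorus.mFourier_zero]; rfl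

theorem integral_mFourier (k : IntLattice n) :
    ∫ x, UnitAddTorus.mFourier k x ∂haarTorus n = if k = 0 then 1 else 0 := by
  have h : ∫ x, UnitAddTorus.mFourier k x ∂haarTorus n
      = ∏ i, ∫ x, fourier (k i) x ∂AddCircle.haarAddCircle (T := (1 : ℝ)) := by
    simp only [UnitAddTorus.mFourier, ContinuousMap.coe_mk, haarTorus]
    exact integral_fintype_prod_eq_prod (𝕜 := ℂ) (fun i (x : UnitAddCircle) => fourier (k i) x)
  rw [h]
  have h1 (j : ℤ) : ∫ x, fourier j x ∂AddCircle.haarAddCircle (T := (1 : ℝ))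
      = if j = 0 then 1 else 0 := by
    have := (orthonormal_iff_ite.mp (orthonormal_fourier (T := (1 : ℝ)))) 0 j
    simp only [ContinuousMap.inner_toLp, fourier_zero, map_one, mul_one] at this
    simpa [eq_comm] using this
  simp only [h1]
  by_cases hk : k = 0
  · subst hk; simp
  · obtain ⟨i, hi⟩ := Function.ne_iff.1 hk
    rw [if_neg hk]
    exact Finset.prod_eq_zero (Finset.mem_univ i) (if_neg hi)

/-! ### Fourier coefficients on the torus -/

/-- The canonical projection `ℝⁿ → 𝕋ⁿ`. -/
def toTorus (x : Fin n → ℝ) : Torus n := fun i => (x i : UnitAddCircle)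

theorem toTorus_surjective : Function.Surjective (toTorus (n := n)) := fun w =>
  ⟨fun i => (QuotientAddGroup.mk_surjective (w i)).choose,
    funext fun i => (QuotientAddGroup.mk_surjective (w i)).choose_spec⟩

theorem continuous_of_continuous_lift {f : Torus n → ℂ} (hf : Continuous (lift f)) :
    Continuous f := by
  have hq : IsOpenQuotientMap (Pi.map fun _ : Fin n => ((↑) : ℝ → UnitAddCircle)) :=
    IsOpenQuotientMap.piMap fun _ => QuotientAddGroup.isOpenQuotientMap_mk
  exact hq.isQuotientMap.continuous_iff.2 hf

/-- The Fourier coefficient `∫ f(x) e^{-2πi s·x} dx`. -/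
def torusCoeff (f : Torus n → ℂ) (s : IntLattice n) : ℂ :=
  ∫ x, UnitAddTorus.mFourier (-s) x * f x ∂haarTorus n

theorem hasSum_torusCoeff {f : Torus n → ℂ} (hf : Continuous f) (h : Summable (torusCoeff f))
    (x : Torus n) : HasSum (fun s => torusCoeff f s * UnitAddTorus.mFourier s x) (f x) :=
  UnitAddTorus.hasSum_mFourier_series_apply_of_summable (f := ⟨f, hf⟩) h x

theorem integrable_of_continuous {f : Torus n → ℂ} (hf : Continuous f) :
    Integrable f (haarTorus n) :=
  hf.integrable_of_hasCompactSupport (HasCompactSupport.of_compactSpace f)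

theorem norm_torusCoeff_le {f : Torus n → ℂ} {B : ℝ} (hB : ∀ x, ‖f x‖ ≤ B) (s : IntLattice n) :
    ‖torusCoeff f s‖ ≤ B := by
  have := norm_integral_le_of_norm_le_const (μ := haarTorus n)
    (f := fun x => UnitAddTorus.mFourier (-s) x * f x) (C := B)
    (Filter.Eventually.of_forall fun x => by rw [norm_mul, norm_mFourier_apply, one_mul]; exact hB x)
  simpa [torusCoeff] using this

theorem torusCoeff_comp_add (f : Torus n → ℂ) (h : Torus n) (s : IntLattice n) :
    torusCoeff (fun x => f (x + h)) s = UnitAddTorus.mFourier s h * torusCoeff f s := by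
  have h1 : ∀ x, UnitAddTorus.mFourier (-s) x * f (x + h)
      = UnitAddTorus.mFourier s h * (UnitAddTorus.mFourier (-s) (x + h) * f (x + h)) := by
    intro x
    rw [mFourier_apply_add]
    linear_combination (-(UnitAddTorus.mFourier (-s) x * f (x + h))) * mFourier_neg_mul_self s h
  simp only [torusCoeff, h1]
  rw [integral_const_mul,
    integral_add_right_eq_self (fun x => UnitAddTorus.mFourier (-s) x * f x) h]

theorem torusCoeff_sub {f g : Torus n → ℂ} (hf : Continuous f) (hg : Continuous g)
    (s : IntLattice n) : torusCoeff (fun x => f x - g x) s = torusCoeff f s - torusCoeff g s := by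
  simp only [torusCoeff, mul_sub]
  exact integral_sub (integrable_of_continuous (by fun_prop)) (integrable_of_continuous (by fun_prop))

/-- Finite differences take the place of integration by parts. The difference f(x + v) - f(x) has
coefficients multiplied by e_s(v) - 1, and by the mean value inequality its N-th derivative is at
most ‖v‖ times the bound on the (N+1)-st derivative of f. -/
theorem norm_mFourier_sub_one_pow_mul_torusCoeff_le (N : ℕ) {f : Torus n → ℂ}
    (hf : ContDiff ℝ ∞ (lift f)) {B : ℝ} (hB : ∀ x, ‖iteratedFDeriv ℝ N (lift f) x‖ ≤ B)
    (s : IntLattice n) (v : Fin n → ℝ) :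
    ‖UnitAddTorus.mFourier s (toTorus v) - 1‖ ^ N * ‖torusCoeff f s‖ ≤ ‖v‖ ^ N * B := by
  induction N generalizing f B with
  | zero =>
    simp only [pow_zero, one_mul]
    refine norm_torusCoeff_le (fun x => ?_) s
    obtain ⟨y, rfl⟩ := toTorus_surjective x
    simpa using! hB y
  | succ N ih =>
    have hfc := continuous_of_continuous_lift hf.continuous
    let g : Torus n → ℂ := fun x => f (x + toTorus v) - f x
    have hg : lift g = (fun x => lift f (x + v)) - lift f := by
      funext x
      simp only [lift, g, Pi.sub_apply]
      congr 2
    have hs : ContDiff ℝ ∞ fun x => lift f (x + v) := hf.comp (contDiff_id.add contDiff_const)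
    have hN : (N : WithTop ℕ∞) ≤ (∞ : WithTop ℕ∞) := by exact_mod_cast le_top
    have hgs : ContDiff ℝ ∞ (lift g) := by rw [hg]; exact hs.sub hf
    have hgB (x) : ‖iteratedFDeriv ℝ N (lift g) x‖ ≤ ‖v‖ * B := by
      rw [hg, iteratedFDeriv_sub_apply (hs.of_le hN).contDiffAt (hf.of_le hN).contDiffAt,
        iteratedFDeriv_comp_add_right]
      have hd : Differentiable ℝ (iteratedFDeriv ℝ N (lift f)) :=
        hf.differentiable_iteratedFDeriv (by exact_mod_cast (WithTop.coe_lt_top N))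
      have := Convex.norm_image_sub_le_of_norm_fderiv_le (𝕜 := ℝ) (s := Set.univ)
        (f := iteratedFDeriv ℝ N (lift f)) (C := B) (x := x) (y := x + v)
        (fun y _ => hd y) (fun y _ => by rw [norm_fderiv_iteratedFDeriv]; exact hB y)
        convex_univ trivial trivial
      rw [mul_comm]
      simpa using this
    have h := ih hgs hgB
    have hc : torusCoeff g s = (UnitAddTorus.mFourier s (toTorus v) - 1) * torusCoeff f s := by
      have := torusCoeff_sub (f := fun x => f (x + toTorus v)) (by fun_prop) hfc s
      rw [torusCoeff_comp_add] at this
      rw [this]; ring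
    rw [hc, norm_mul] at h
    calc _ = _ := by rw [pow_succ, mul_assoc]
      _ ≤ _ := h
      _ = _ := by ring

theorem norm_pow_mul_torusCoeff_le (N : ℕ) {f : Torus n → ℂ}
    (hf : ContDiff ℝ ∞ (lift f)) {B : ℝ} (hB : ∀ x, ‖iteratedFDeriv ℝ N (lift f) x‖ ≤ B)
    (s : IntLattice n) : ‖s‖ ^ N * ‖torusCoeff f s‖ ≤ B := by
  have hB0 : 0 ≤ B := (norm_nonneg _).trans (hB 0)
  rcases eq_or_ne s 0 with rfl | hs
  · rcases Nat.eq_zero_or_pos N with rfl | hN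
    · simpa using norm_mFourier_sub_one_pow_mul_torusCoeff_le 0 hf hB 0 0
    · simpa [hN.ne'] using hB0
  · obtain ⟨i, hi⟩ : ∃ i, ‖s‖ = ‖s i‖ := by
      by_contra! h
      have : ‖s‖ < ‖s‖ := (pi_norm_lt_iff (norm_pos_iff.2 hs)).2
        fun i => lt_of_le_of_ne (norm_le_pi_norm s i) (h i).symm
      exact lt_irrefl _ this
    have hpos : 0 < ‖s‖ := norm_pos_iff.2 hs
    have hsi : (s i : ℝ) ≠ 0 := by
      intro h0
      have : s i = 0 := by exact_mod_cast h0
      rw [hi, this] at hpos; simp at hpos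
    -- Half a period in the direction of the largest frequency: e_s(v) = -1 with ‖v‖ = 1/(2‖s‖). The
    -- difference estimate then gives the claim with a factor 4^N to spare.
    let v : Fin n → ℝ := Pi.single i (1 / (2 * s i))
    have hv : ‖v‖ = (2 * ‖s‖)⁻¹ := by
      rw [Pi.norm_single, hi]
      simp [Int.norm_eq_abs]
    have he : UnitAddTorus.mFourier s (toTorus v) = -1 := by
      simp only [UnitAddTorus.mFourier, ContinuousMap.coe_mk]
      rw [Finset.prod_eq_single i]
      · simp only [toTorus, v, Pi.single_eq_same]
        rw [fourier_coe_apply]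
        have hsc : (s i : ℂ) ≠ 0 := by exact_mod_cast hsi
        rw [← Complex.exp_pi_mul_I]
        congr 1
        push_cast
        field_simp
      · intro j _ hj
        simp [toTorus, v, Pi.single_eq_of_ne hj]
      · simp
    have h := norm_mFourier_sub_one_pow_mul_torusCoeff_le N hf hB s v
    rw [he, hv, show ‖(-1 - 1 : ℂ)‖ = 2 by norm_num, inv_pow, mul_pow,
      inv_mul_eq_div, le_div_iff₀ (by positivity)] at h
    have h1 : (1 : ℝ) ≤ 2 ^ N * 2 ^ N := by
      rw [← pow_add]; exact one_le_pow₀ (by norm_num)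
    calc _ ≤ (2 ^ N * 2 ^ N) * (‖s‖ ^ N * ‖torusCoeff f s‖) :=
          le_mul_of_one_le_left (by positivity) h1
      _ = _ := by ring
      _ ≤ B := h

theorem one_add_norm_pow_mul_torusCoeff_le (N : ℕ) {f : Torus n → ℂ}
    (hf : ContDiff ℝ ∞ (lift f)) {A B : ℝ} (hA : ∀ x, ‖iteratedFDeriv ℝ 0 (lift f) x‖ ≤ A)
    (hB : ∀ x, ‖iteratedFDeriv ℝ N (lift f) x‖ ≤ B)
    (s : IntLattice n) : (1 + ‖s‖) ^ N * ‖torusCoeff f s‖ ≤ 2 ^ (N - 1) * (A + B) := by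
  have h0 := norm_pow_mul_torusCoeff_le 0 hf hA s
  have hN := norm_pow_mul_torusCoeff_le N hf hB s
  rw [pow_zero, one_mul] at h0
  -- Convexity of t ↦ t^N; for N = 0 the truncated exponent N - 1 is 0 and the bound still holds.
  calc _ ≤ (2 ^ (N - 1) * (1 ^ N + ‖s‖ ^ N)) * ‖torusCoeff f s‖ := by
        gcongr; exact add_pow_le zero_le_one (norm_nonneg s) N
    _ = 2 ^ (N - 1) * (‖torusCoeff f s‖ + ‖s‖ ^ N * ‖torusCoeff f s‖) := by ring
    _ ≤ _ := by gcongr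

/-! ### Derivatives of the characters -/

/-- The character is t ↦ e^{2πit} after the linear form y ↦ s·y, whose norm for the sup norm on ℝⁿ
is at most n(1 + ‖s‖). -/
theorem norm_iteratedFDeriv_lift_mFourier_le (s : IntLattice n) (l : ℕ) (x : Fin n → ℝ) :
    ‖iteratedFDeriv ℝ l (lift fun y : Torus n => UnitAddTorus.mFourier s y) x‖
      ≤ (2 * Real.pi * n) ^ l * (1 + ‖s‖) ^ l := by
  let g : (Fin n → ℝ) →L[ℝ] ℝ := ∑ i, (s i : ℝ) • ContinuousLinearMap.proj i
  let c : ℂ := 2 * Real.pi * Complex.I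
  let h : ℝ → ℂ := fun t => Complex.exp (c * t)
  have hh : ContDiff ℝ ∞ h := by
    refine ContDiff.cexp (contDiff_const.mul Complex.ofRealCLM.contDiff)
  have hfun : (lift fun y : Torus n => UnitAddTorus.mFourier s y) = h ∘ g := by
    funext y
    simp only [lift, UnitAddTorus.mFourier, ContinuousMap.coe_mk, fourier_coe_apply, h, c,
      Function.comp, ← Complex.exp_sum, g]
    congr 1
    simp [Finset.mul_sum, mul_assoc]
  have hg : ‖g‖ ≤ n * (1 + ‖s‖) := by
    refine ContinuousLinearMap.opNorm_le_bound _ (by positivity) fun y => ?_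
    have : g y = ∑ i, (s i : ℝ) * y i := by simp [g]
    rw [this]
    calc _ ≤ ∑ i : Fin n, ‖(s i : ℝ) * y i‖ := norm_sum_le _ _
      _ ≤ ∑ _i : Fin n, (1 + ‖s‖) * ‖y‖ := by
          refine Finset.sum_le_sum fun i _ => ?_
          rw [norm_mul]
          have h1 : ‖(s i : ℝ)‖ ≤ 1 + ‖s‖ := by
            have := norm_le_pi_norm s i
            rw [Int.norm_cast_real]; linarith
          gcongr
          exact norm_le_pi_norm y i
      _ = _ := by simp; ring
  have hd (t : ℝ) : ‖iteratedFDeriv ℝ l h t‖ = (2 * Real.pi) ^ l := by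
    rw [norm_iteratedFDeriv_eq_norm_iteratedDeriv]
    have : iteratedDeriv l h = fun t : ℝ => c ^ l * Complex.exp (c * t) := by
      induction l with
      | zero => simp [h]
      | succ l ih =>
        rw [iteratedDeriv_succ, ih]
        funext t
        have h1 : HasDerivAt (fun t : ℝ => c * (t : ℂ)) c t := by
          simpa using (Complex.ofRealCLM.hasDerivAt (x := t)).const_mul c
        have h2 := (h1.cexp.const_mul (c ^ l)).deriv
        rw [h2]; ring
    rw [this]
    have h1 : ‖Complex.exp (c * t)‖ = 1 := by
      rw [Complex.norm_exp]; simp [c]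
    rw [norm_mul, h1, norm_pow, mul_one]
    congr 1
    simp [c, abs_of_pos Real.pi_pos]
  rw [hfun, g.iteratedFDeriv_comp_right hh x (i := l) (by exact_mod_cast le_top)]
  refine (ContinuousMultilinearMap.norm_compContinuousLinearMap_le _ _).trans ?_
  rw [hd, Finset.prod_const, Finset.card_univ, Fintype.card_fin]
  calc _ ≤ (2 * Real.pi) ^ l * (n * (1 + ‖s‖)) ^ l := by gcongr
    _ = _ := by simp only [mul_pow]; ring

/-! ### Expansions in the Schwartz spaces -/

theorem norm_sub_sum_le_tsum_sub_sum {ι E : Type*} [NormedAddCommGroup E] {G : ι → E} {a : E}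
    {u : ι → ℝ} (hG : HasSum G a) (hu : Summable u) (h : ∀ i, ‖G i‖ ≤ u i) (A : Finset ι) :
    ‖a - ∑ i ∈ A, G i‖ ≤ ∑' i, u i - ∑ i ∈ A, u i := by
  classical
  have h1 : Filter.Tendsto (fun B : Finset ι => ‖∑ i ∈ B, G i - ∑ i ∈ A, G i‖) Filter.atTop
      (𝓝 ‖a - ∑ i ∈ A, G i‖) := (Filter.Tendsto.sub_const hG _).norm
  refine le_of_tendsto h1 ?_
  filter_upwards [Filter.eventually_ge_atTop A] with B hB
  rw [← Finset.sum_sdiff hB, add_sub_cancel_right]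
  calc _ ≤ ∑ i ∈ B \ A, u i := norm_sum_le_of_le _ fun i _ => h i
    _ = ∑ i ∈ B, u i - ∑ i ∈ A, u i := by rw [← Finset.sum_sdiff hB]; ring
    _ ≤ _ := by
      gcongr
      exact hu.sum_le_tsum _ fun i _ => (norm_nonneg _).trans (h i)

/-- Here `D` is an evaluation at one point and `c` its weight. The right side does not depend on
them, so the supremum defining a Schwartz seminorm can be taken afterwards. -/
theorem mul_norm_map_sub_sum_le {X E ι : Type*} [AddCommGroup X] [Module ℂ X]
    [NormedAddCommGroup E] [NormedSpace ℂ E] (D : X →ₗ[ℂ] E) {f : ι → X} {a : X} {u : ι → ℝ}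
    {c : ℝ} (hc : 0 ≤ c) (hs : HasSum (fun i => D (f i)) (D a)) (hu : Summable u)
    (h : ∀ i, c * ‖D (f i)‖ ≤ u i) (A : Finset ι) :
    c * ‖D (a - ∑ i ∈ A, f i)‖ ≤ ∑' i, u i - ∑ i ∈ A, u i := by
  have h1 := norm_sub_sum_le_tsum_sub_sum (hs.const_smul (c : ℂ)) hu (fun i => by
    rw [norm_smul, Complex.norm_real, Real.norm_of_nonneg hc]; exact h i) A
  rwa [← Finset.smul_sum, ← smul_sub, norm_smul, Complex.norm_real, Real.norm_of_nonneg hc,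
    ← map_sum, ← map_sub] at h1

theorem hasSum_of_seminorm_le {E κ ι : Type*} [AddCommGroup E] [Module ℂ E] [TopologicalSpace E]
    [Nonempty κ] {P : SeminormFamily ℂ E κ} (hP : WithSeminorms P) {f : ι → E} {a : E}
    (u : κ → ι → ℝ) (hu : ∀ i, Summable (u i))
    (h : ∀ i (A : Finset ι), P i (a - ∑ x ∈ A, f x) ≤ ∑' x, u i x - ∑ x ∈ A, u i x) :
    HasSum f a := by
  have : Filter.Tendsto (fun A : Finset ι => ∑ x ∈ A, f x) Filter.atTop (𝓝 a) := by
    rw [hP.tendsto_nhds]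
    intro i ε hε
    have h1 : Filter.Tendsto (fun A : Finset ι => ∑' x, u i x - ∑ x ∈ A, u i x) Filter.atTop
        (𝓝 0) := by
      simpa using Filter.Tendsto.const_sub (∑' x, u i x) (hu i).hasSum
    filter_upwards [h1.eventually_lt_const hε] with A hA
    rw [map_sub_rev]
    exact (h i A).trans_lt hA
  exact this

namespace SchwartzZ

theorem withSeminorms (n : ℕ) : WithSeminorms (SchwartzZ.seminorm n) := ⟨rfl⟩

theorem le_seminorm (φ : SchwartzZ n) (j : ℕ) (k : IntLattice n) :
    (1 + ‖k‖) ^ j * ‖φ k‖ ≤ seminorm n j φ := le_ciSup (φ.bddAbove j) k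

/-- Evaluation at a lattice point, as a linear map. -/
def evalₗ (k : IntLattice n) : SchwartzZ n →ₗ[ℂ] ℂ where
  toFun φ := φ k
  map_add' _ _ := rfl
  map_smul' _ _ := rfl

theorem delta_apply (k m : IntLattice n) : delta k m = if m = k then 1 else 0 :=
  Pi.single_apply k 1 m

/-- Convergence in the Schwartz topology, not merely pointwise, so that a tempered distribution may
be applied term by term. -/
theorem hasSum_delta (φ : SchwartzZ n) : HasSum (fun k => φ k • delta k) φ := by
  have hu (j : ℕ) : Summable fun k => (1 + ‖k‖) ^ j * ‖φ k‖ := by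
    -- The n + 1 extra powers of decay pay for summability over ℤⁿ.
    obtain ⟨C, hC⟩ := φ.decay (j + (n + 1))
    refine Summable.of_nonneg_of_le (fun k => by positivity) (fun k => ?_)
      ((summable_inv_one_add_norm_pow n).mul_left C)
    have hp : 0 < (1 + ‖k‖) ^ (n + 1) := by positivity
    rw [← div_eq_mul_inv, le_div_iff₀ hp]
    calc _ = (1 + ‖k‖) ^ (j + (n + 1)) * ‖φ k‖ := by rw [pow_add]; ring
      _ ≤ C := hC k
  refine hasSum_of_seminorm_le (withSeminorms n) _ hu fun j A => ciSup_le fun k => ?_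
  refine mul_norm_map_sub_sum_le (evalₗ k) (by positivity) ?_ (hu j) (fun x => ?_) A
  · have h1 := hasSum_single (f := fun x => φ x * delta x k) k
      (fun x hx => by simp [delta_apply, hx.symm])
    have h2 : φ k * delta k k = φ k := by simp [delta_apply]
    rw [h2] at h1
    exact h1
  · change (1 + ‖k‖) ^ j * ‖φ x * delta x k‖ ≤ _
    rw [norm_mul, delta_apply]
    split_ifs with hkx
    · subst hkx; simp
    · simp; positivity

end SchwartzZ

theorem TemperedZ.hasSum_coeff (f : TemperedZ n) (φ : SchwartzZ n) :
    HasSum (fun k => f.coeff k * φ k) (f φ) := by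
  have := (SchwartzZ.hasSum_delta φ).mapL f
  simpa [TemperedZ.coeff, mul_comm] using this

namespace SchwartzZT

theorem withSeminorms (n : ℕ) : WithSeminorms (SchwartzZT.seminorm n) := ⟨rfl⟩

theorem continuous (φ : SchwartzZT n) (k : IntLattice n) : Continuous (φ k) :=
  continuous_of_continuous_lift (φ.smooth k).continuous

theorem lift_zero : lift (fun _ : Torus n => 0) = fun _ => (0 : ℂ) := rfl

/-- The Schwartz function `δ_k ⊗ e^{2πi s·x}`. -/
def basis (k s : IntLattice n) : SchwartzZT n :=
  ⟨fun m x => if m = k then UnitAddTorus.mFourier s x else 0, by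
    refine ⟨fun m => ?_, fun j l => ⟨(1 + ‖k‖) ^ j *
      ((2 * Real.pi * n) ^ l * (1 + ‖s‖) ^ l), fun m x => ?_⟩⟩
    · by_cases h : m = k
      · simp only [h, if_true]; exact contDiff_lift_mFourier s
      · simp only [h, if_false]; exact contDiff_const
    · by_cases h : m = k
      · simp only [h, if_true]
        gcongr
        exact norm_iteratedFDeriv_lift_mFourier_le s l x
      · simp only [h, if_false, lift_zero]
        have : iteratedFDeriv ℝ l (fun _ : Fin n → ℝ => (0 : ℂ)) x = 0 := by
          simp
        rw [this, norm_zero, mul_zero]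
        have := Real.pi_pos
        positivity⟩

theorem basis_apply (k s m : IntLattice n) (x : Torus n) :
    basis k s m x = if m = k then UnitAddTorus.mFourier s x else 0 := rfl

theorem coeff_decay (φ : SchwartzZT n) (j N : ℕ) : ∃ C : ℝ, ∀ k s : IntLattice n,
    (1 + ‖k‖) ^ j * (1 + ‖s‖) ^ N * ‖torusCoeff (φ k) s‖ ≤ C := by
  obtain ⟨A, hA⟩ := φ.decay j 0
  obtain ⟨B, hB⟩ := φ.decay j N
  refine ⟨2 ^ (N - 1) * (A + B), fun k s => ?_⟩
  have hp : 0 < (1 + ‖k‖) ^ j := by positivity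
  have := one_add_norm_pow_mul_torusCoeff_le N (φ.smooth k)
    (A := A / (1 + ‖k‖) ^ j) (B := B / (1 + ‖k‖) ^ j)
    (fun x => by rw [le_div_iff₀ hp, mul_comm]; exact hA k x)
    (fun x => by rw [le_div_iff₀ hp, mul_comm]; exact hB k x) s
  rw [← add_div, ← mul_div_assoc, le_div_iff₀ hp] at this
  linarith

theorem summable_coeff (φ : SchwartzZT n) (j l : ℕ) :
    Summable fun z : IntLattice n × IntLattice n =>
      (1 + ‖z.1‖) ^ j * (1 + ‖z.2‖) ^ l * ‖torusCoeff (φ z.1) z.2‖ := by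
  obtain ⟨C, hC⟩ := φ.coeff_decay (j + (n + 1)) (l + (n + 1))
  have h := (summable_inv_one_add_norm_pow n).mul_of_nonneg (summable_inv_one_add_norm_pow n)
    (fun _ => by positivity) (fun _ => by positivity)
  refine Summable.of_nonneg_of_le (fun z => by positivity) (fun z => ?_) (h.mul_left C)
  have hp : 0 < (1 + ‖z.1‖) ^ (n + 1) := by positivity
  have hq : 0 < (1 + ‖z.2‖) ^ (n + 1) := by positivity
  rw [← mul_inv, ← div_eq_mul_inv, le_div_iff₀ (by positivity)]
  calc _ = (1 + ‖z.1‖) ^ (j + (n + 1)) * (1 + ‖z.2‖) ^ (l + (n + 1)) *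
        ‖torusCoeff (φ z.1) z.2‖ := by rw [pow_add, pow_add]; ring
    _ ≤ C := hC _ _

theorem hasSum_apply (φ : SchwartzZT n) (k : IntLattice n) (x : Torus n) :
    HasSum (fun s => torusCoeff (φ k) s * UnitAddTorus.mFourier s x) (φ k x) := by
  refine hasSum_torusCoeff (φ.continuous k) (Summable.of_norm ?_) x
  have := (φ.summable_coeff 0 0).prod_factor k
  simpa using this

/-- The coefficients decay faster than any power of ‖s‖, while i derivatives of e_s cost only (1 +
‖s‖)^i up to a constant; the Fourier series may be differentiated termwise. -/
theorem hasSum_iteratedFDeriv (φ : SchwartzZT n) (k : IntLattice n) (l : ℕ) (x : Fin n → ℝ) :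
    HasSum (fun s => torusCoeff (φ k) s •
      iteratedFDeriv ℝ l (lift fun y : Torus n => UnitAddTorus.mFourier s y) x)
      (iteratedFDeriv ℝ l (lift (φ k)) x) := by
  let E : IntLattice n → (Fin n → ℝ) → ℂ := fun s => torusCoeff (φ k) s •
    lift fun y : Torus n => UnitAddTorus.mFourier s y
  have hl : lift (φ k) = fun y => ∑' s, E s y := by
    funext y
    exact (φ.hasSum_apply k _).tsum_eq.symm
  have hE (s) : ContDiff ℝ ∞ (E s) :=
    contDiff_const.smul (contDiff_lift_mFourier s)
  let v : ℕ → IntLattice n → ℝ := fun i s =>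
    (2 * Real.pi * n) ^ i * ((1 + ‖s‖) ^ i * ‖torusCoeff (φ k) s‖)
  have hd (i : ℕ) (s) (y) : iteratedFDeriv ℝ i (E s) y = torusCoeff (φ k) s •
      iteratedFDeriv ℝ i (lift fun y : Torus n => UnitAddTorus.mFourier s y) y :=
    iteratedFDeriv_const_smul_apply
      (((contDiff_lift_mFourier s).of_le (by exact_mod_cast le_top)).contDiffAt)
  have hEv (i : ℕ) (s) (y) : ‖iteratedFDeriv ℝ i (E s) y‖ ≤ v i s := by
    rw [hd, norm_smul]
    calc _ ≤ ‖torusCoeff (φ k) s‖ * ((2 * Real.pi * n) ^ i * (1 + ‖s‖) ^ i) := by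
          gcongr; exact norm_iteratedFDeriv_lift_mFourier_le s i y
      _ = _ := by simp only [v]; ring
  have hv (i : ℕ) : Summable (v i) := by
    refine Summable.mul_left _ ?_
    have := (φ.summable_coeff 0 i).prod_factor k
    simpa using this
  have h := iteratedFDeriv_tsum_apply (𝕜 := ℝ) (N := ⊤) (f := E) (v := v)
    (fun s => hE s) (fun i _ => hv i) (fun i s y _ => hEv i s y) (k := l) le_top x
  rw [hl, h]
  simp only [← hd]
  exact (Summable.of_norm_bounded (hv l) (fun s => hEv l s x)).hasSum

/-- The derivatives `D_x^l φ(k, x)`, as a linear map in `φ`. -/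
def iteratedFDerivₗ (l : ℕ) (k : IntLattice n) (x : Fin n → ℝ) :
    SchwartzZT n →ₗ[ℂ] ContinuousMultilinearMap ℝ (fun _ : Fin l => Fin n → ℝ) ℂ where
  toFun φ := iteratedFDeriv ℝ l (lift (φ k)) x
  map_add' f g := iteratedFDeriv_add_apply ((f.smooth _).of_le (by exact_mod_cast le_top)).contDiffAt
          ((g.smooth _).of_le (by exact_mod_cast le_top)).contDiffAt
  map_smul' c f := by
    change iteratedFDeriv ℝ l (c • lift (f k)) x = c • iteratedFDeriv ℝ l (lift (f k)) x
    exact iteratedFDeriv_const_smul_apply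
      ((f.smooth _).of_le (by exact_mod_cast le_top)).contDiffAt

theorem hasSum_basis (φ : SchwartzZT n) :
    HasSum (fun z : IntLattice n × IntLattice n => torusCoeff (φ z.1) z.2 • basis z.1 z.2) φ := by
  let u : ℕ × ℕ → IntLattice n × IntLattice n → ℝ := fun i z => (2 * Real.pi * n) ^ i.2 *
    ((1 + ‖z.1‖) ^ i.1 * (1 + ‖z.2‖) ^ i.2 * ‖torusCoeff (φ z.1) z.2‖)
  have hu (i) : Summable (u i) := (φ.summable_coeff i.1 i.2).mul_left _
  refine hasSum_of_seminorm_le (withSeminorms n) u hu fun i A => ciSup_le fun y => ?_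
  obtain ⟨k, x⟩ := y
  obtain ⟨j, l⟩ := i
  let D := iteratedFDerivₗ (n := n) l k x
  have hbk (c : ℂ) (s) : D (c • basis k s) = c •
      iteratedFDeriv ℝ l (lift fun y : Torus n => UnitAddTorus.mFourier s y) x := by
    rw [map_smul]
    change c • iteratedFDeriv ℝ l (lift fun y => basis k s k y) x = _
    simp only [basis_apply, if_true]
  have hb0 (c : ℂ) (m s) (hm : k ≠ m) : D (c • basis m s) = 0 := by
    change iteratedFDeriv ℝ l (lift fun y => c * basis m s k y) x = _
    simp only [basis_apply, if_neg hm, mul_zero, lift_zero]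
    simp
  refine mul_norm_map_sub_sum_le D (by positivity) ?_ (hu (j, l)) (fun z => ?_) A
  -- Only terms supported on the slice k are seen by `D`, which leaves the Fourier series of φ(k,
  -- ·).
  · refine (Function.Injective.hasSum_iff (Prod.mk_right_injective k) ?_).1 ?_
    · rintro ⟨m, s⟩ hz
      refine hb0 _ m s ?_
      rintro rfl; exact hz ⟨s, rfl⟩
    · simp only [Function.comp_def, hbk]
      exact φ.hasSum_iteratedFDeriv k l x
  · obtain ⟨m, s⟩ := z
    rcases eq_or_ne k m with rfl | hm
    · simp only [hbk, norm_smul]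
      calc _ ≤ (1 + ‖k‖) ^ j * (‖torusCoeff (φ k) s‖ *
            ((2 * Real.pi * n) ^ l * (1 + ‖s‖) ^ l)) := by
            gcongr; exact norm_iteratedFDeriv_lift_mFourier_le s _ x
        _ = _ := by simp only [u]; ring
    · simp only [hb0 _ m s hm, norm_zero, mul_zero, u]
      have := Real.pi_pos
      positivity

end SchwartzZT

/-- The coefficient `⟨ς, δ_k ⊗ e^{2πi s·x}⟩`. -/
def TemperedZT.coeff (ς : TemperedZT n) (z : IntLattice n × IntLattice n) : ℂ :=
  ς (SchwartzZT.basis z.1 z.2)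

theorem TemperedZT.hasSum_coeff (ς : TemperedZT n) (φ : SchwartzZT n) :
    HasSum (fun z : IntLattice n × IntLattice n => ς.coeff z * torusCoeff (φ z.1) z.2) (ς φ) := by
  have := (SchwartzZT.hasSum_basis φ).mapL ς
  simpa [TemperedZT.coeff, mul_comm] using this

/-! ### Series of characters -/

theorem measurable_of_hasSum {ι X : Type*} [Countable ι] [MeasurableSpace X] {f : ι → X → ℂ}
    {g : X → ℂ} (hf : ∀ i, Measurable (f i)) (h : ∀ x, HasSum (fun i => f i x) (g x)) :
    Measurable g := by
  refine measurable_of_tendsto_metrizable' (f := fun (A : Finset ι) x => ∑ i ∈ A, f i x)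
    Filter.atTop (fun A => Finset.measurable_sum _ fun i _ => hf i) ?_
  exact tendsto_pi_nhds.2 fun x => h x

/-- Integration against the conjugate of χ i₀ isolates c i₀. The common engine of both
identifications of modulation spaces. -/
theorem enorm_coeff_le_lintegral {Ω ι : Type*} [Countable ι] [MeasurableSpace Ω] {μ : Measure Ω}
    [IsProbabilityMeasure μ] {χ : ι → Ω → ℂ} (hχ : ∀ i, Measurable (χ i))
    (hχ1 : ∀ i y, ‖χ i y‖ = 1) {i₀ : ι}
    (horth : ∀ i, i ≠ i₀ → ∫ y, χ i y * conj (χ i₀ y) ∂μ = 0) {c : ι → ℂ} {V : Ω → ℂ}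
    (h : ∀ y, HasSum (fun i => c i * χ i y) (V y)) : ‖c i₀‖ₑ ≤ ∫⁻ y, ‖V y‖ₑ ∂μ := by
  have hne : Nonempty Ω := nonempty_of_isProbabilityMeasure μ
  -- Unconditional convergence in ℂ is absolute and |χ i| = 1, so convergence at a single point
  -- already makes c summable and justifies termwise integration.
  have hc : Summable fun i => ‖c i‖ := by
    have := (h hne.some).summable.norm
    simpa [hχ1] using this
  let F : ι → Ω → ℂ := fun i y => c i * χ i y * conj (χ i₀ y)
  have hFn (i y) : ‖F i y‖ = ‖c i‖ := by simp [F, hχ1]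
  have hFm (i) : Measurable (F i) :=
    ((hχ i).const_mul _).mul (Complex.continuous_conj.measurable.comp (hχ i₀))
  have hFi (i) : Integrable (F i) μ :=
    Integrable.of_bound (hFm i).aestronglyMeasurable ‖c i‖
      (Filter.Eventually.of_forall fun y => (hFn i y).le)
  have h1 := hasSum_integral_of_summable_integral_norm hFi (by simpa [hFn] using hc)
  have h2 (y) : ∑' i, F i y = V y * conj (χ i₀ y) := ((h y).mul_right _).tsum_eq
  have h3 (i) : ∫ y, F i y ∂μ = c i * ∫ y, χ i y * conj (χ i₀ y) ∂μ := by
    simp only [F, mul_assoc]; exact integral_const_mul _ _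
  have h4 : ∫ y, F i₀ y ∂μ = c i₀ := by
    have hy (y) : χ i₀ y * conj (χ i₀ y) = 1 := by
      rw [Complex.mul_conj, Complex.normSq_eq_norm_sq, hχ1]; simp
    rw [h3]; simp [hy]
  have h5 := hasSum_single (f := fun i => ∫ y, F i y ∂μ) i₀ fun i hi => by
    rw [h3, horth i hi, mul_zero]
  have h6 := h1.unique h5
  rw [h4] at h6
  simp only [h2] at h6
  rw [← h6]
  refine (enorm_integral_le_lintegral_enorm _).trans (le_of_eq (lintegral_congr fun y => ?_))
  rw [enorm_mul, RCLike.enorm_conj]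
  have : ‖χ i₀ y‖ₑ = 1 := by rw [← ofReal_norm, hχ1]; simp
  rw [this, mul_one]

theorem mFourier_mul_conj (k m : IntLattice n) (x : Torus n) :
    UnitAddTorus.mFourier k x * conj (UnitAddTorus.mFourier m x)
      = UnitAddTorus.mFourier (k - m) x := by
  rw [← UnitAddTorus.mFourier_neg, sub_eq_add_neg, UnitAddTorus.mFourier_add]

theorem continuous_mFourier : Continuous fun z : IntLattice n × Torus n =>
    UnitAddTorus.mFourier z.1 z.2 := by
  have : Continuous fun k : IntLattice n => (UnitAddTorus.mFourier k : C(Torus n, ℂ)) :=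
    continuous_of_discreteTopology
  exact ContinuousEval.continuous_eval.comp (this.prodMap continuous_id)

/-! ### The short-time Fourier transform on `ℤⁿ × 𝕋ⁿ` -/

/-- The Fourier coefficients of the conjugate of `Γ(j, ·)`. -/
def SchwartzZT.conjCoeff (Γ : SchwartzZT n) (j t : IntLattice n) : ℂ :=
  torusCoeff (fun x => conj (Γ j x)) t

/-- After conjugation, modulation by l becomes the frequency shift s ↦ s + l and translation by w a
phase. Thus for fixed (m, l) the transform is a character series in (w, ξ). -/
theorem torusCoeff_conjShift (Γ : SchwartzZT n) (m : IntLattice n) (w ξ : Torus n)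
    (l k s : IntLattice n) :
    torusCoeff (Γ.conjShift m w ξ l k) s = Γ.conjCoeff (k - m) (s + l) *
      (UnitAddTorus.mFourier (-k) ξ * UnitAddTorus.mFourier (-(s + l)) w) := by
  have h := torusCoeff_comp_add (fun x => conj (Γ (k - m) x)) (-w) (s + l)
  rw [mFourier_apply_neg] at h
  have h1 : torusCoeff (Γ.conjShift m w ξ l k) s = UnitAddTorus.mFourier (-k) ξ *
      torusCoeff (fun x => conj (Γ (k - m) (x + -w))) (s + l) := by
    unfold torusCoeff
    rw [← integral_const_mul]
    refine integral_congr_ae (Filter.Eventually.of_forall fun x => ?_)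
    change UnitAddTorus.mFourier (-s) x * conj (UnitAddTorus.mFourier k ξ *
      UnitAddTorus.mFourier l x * Γ (k - m) (x - w)) = _
    simp only [map_mul, ← UnitAddTorus.mFourier_neg, neg_add, UnitAddTorus.mFourier_add,
      sub_eq_add_neg]
    ring
  rw [h1, h, SchwartzZT.conjCoeff]
  ring

theorem hasSum_stftZT (Γ : SchwartzZT n) (ς : TemperedZT n)
    (z : (IntLattice n × Torus n) × (Torus n × IntLattice n)) :
    HasSum (fun x : IntLattice n × IntLattice n =>
      ς.coeff x * Γ.conjCoeff (x.1 - z.1.1) (x.2 + z.2.2) *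
        (UnitAddTorus.mFourier (-x.1) z.2.1 * UnitAddTorus.mFourier (-(x.2 + z.2.2)) z.1.2))
      (stftZT Γ ς z) := by
  have := ς.hasSum_coeff (Γ.conjShift z.1.1 z.1.2 z.2.1 z.2.2)
  simp only [torusCoeff_conjShift, ← mul_assoc] at this
  simpa only [← mul_assoc, stftZT] using this

theorem measurable_stftZT (Γ : SchwartzZT n) (ς : TemperedZT n) : Measurable (stftZT Γ ς) := by
  have : OpensMeasurableSpace ((IntLattice n × Torus n) × (Torus n × IntLattice n)) :=
    Prod.opensMeasurableSpace
  refine measurable_of_hasSum (fun x => Continuous.measurable ?_) (hasSum_stftZT Γ ς)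
  have h1 : Continuous fun q : IntLattice n × IntLattice n =>
      ς.coeff x * Γ.conjCoeff (x.1 - q.1) (x.2 + q.2) := continuous_of_discreteTopology
  have h2 : Continuous fun z : (IntLattice n × Torus n) × (Torus n × IntLattice n) =>
      ς.coeff x * Γ.conjCoeff (x.1 - z.1.1) (x.2 + z.2.2) :=
    h1.comp (f := fun z : (IntLattice n × Torus n) × (Torus n × IntLattice n) =>
      (z.1.1, z.2.2)) (by fun_prop)
  have h3 : Continuous fun z : (IntLattice n × Torus n) × (Torus n × IntLattice n) =>
      UnitAddTorus.mFourier (-(x.2 + z.2.2)) z.1.2 :=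
    continuous_mFourier.comp (f := fun z : (IntLattice n × Torus n) × (Torus n × IntLattice n) =>
      (-(x.2 + z.2.2), z.1.2)) (by fun_prop)
  exact h2.mul (Continuous.mul (by fun_prop) h3)

theorem enorm_coeff_mul_conjCoeff_le (Γ : SchwartzZT n) (ς : TemperedZT n)
    (k s m l : IntLattice n) :
    ‖ς.coeff (k, s)‖ₑ * ‖Γ.conjCoeff (k - m) (s + l)‖ₑ ≤
      ∫⁻ y, ‖stftZT Γ ς ((m, y.1), (y.2, l))‖ₑ ∂((haarTorus n).prod (haarTorus n)) := by
  have h := enorm_coeff_le_lintegral (μ := (haarTorus n).prod (haarTorus n))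
    (χ := fun (x : IntLattice n × IntLattice n) (y : Torus n × Torus n) =>
      UnitAddTorus.mFourier (-x.1) y.2 * UnitAddTorus.mFourier (-(x.2 + l)) y.1) (i₀ := (k, s))
    (c := fun x => ς.coeff x * Γ.conjCoeff (x.1 - m) (x.2 + l))
    (V := fun y => stftZT Γ ς ((m, y.1), (y.2, l)))
    (fun x => Continuous.measurable (by fun_prop))
    (fun x y => by simp only [norm_mul, norm_mFourier_apply, mul_one]) (fun x hx => ?_)
    (fun y => hasSum_stftZT Γ ς ((m, y.1), (y.2, l)))
  · rwa [enorm_mul] at h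
  · have h1 (y : Torus n × Torus n) :
        UnitAddTorus.mFourier (-x.1) y.2 * UnitAddTorus.mFourier (-(x.2 + l)) y.1 *
          conj (UnitAddTorus.mFourier (-k) y.2 * UnitAddTorus.mFourier (-(s + l)) y.1)
        = UnitAddTorus.mFourier (s - x.2) y.1 * UnitAddTorus.mFourier (k - x.1) y.2 := by
      have e1 := mFourier_mul_conj (-x.1) (-k) y.2
      have e2 := mFourier_mul_conj (-(x.2 + l)) (-(s + l)) y.1
      rw [show -x.1 - -k = k - x.1 by abel] at e1
      rw [show -(x.2 + l) - -(s + l) = s - x.2 by abel] at e2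
      rw [← e1, ← e2, map_mul]
      ring
    simp only [h1]
    rw [integral_prod_mul (fun y : Torus n => UnitAddTorus.mFourier (s - x.2) y)
      (fun y : Torus n => UnitAddTorus.mFourier (k - x.1) y), integral_mFourier, integral_mFourier]
    by_cases h2 : s - x.2 = 0
    · by_cases h3 : k - x.1 = 0
      · exact absurd (Prod.ext (sub_eq_zero.1 h3).symm (sub_eq_zero.1 h2).symm) hx
      · simp [h3]
    · simp [h2]

theorem lintegral_phase_prod (f : (IntLattice n × Torus n) × (Torus n × IntLattice n) → ℝ≥0∞)
    (hf : Measurable f) :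
    ∫⁻ z, f z ∂((phaseMeasure n).prod ((haarTorus n).prod Measure.count)) =
      ∑' x : IntLattice n × IntLattice n,
        ∫⁻ y, f ((x.1, y.1), (y.2, x.2)) ∂((haarTorus n).prod (haarTorus n)) := by
  have hm (m l : IntLattice n) :
      Measurable fun y : Torus n × Torus n => f ((m, y.1), (y.2, l)) :=
    hf.comp (by fun_prop)
  rw [lintegral_prod _ hf.aemeasurable, phaseMeasure, lintegral_prod _ (by fun_prop),
    lintegral_count, ENNReal.tsum_prod']
  refine tsum_congr fun m => ?_
  rw [← lintegral_tsum fun l => (hm m l).aemeasurable,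
    lintegral_prod _ (Measurable.aemeasurable (Measurable.tsum fun l => hm m l))]
  refine lintegral_congr fun w => ?_
  rw [lintegral_prod _ (by fun_prop)]
  refine lintegral_congr fun ξ => ?_
  rw [lintegral_count]

theorem exists_conjCoeff_ne_zero {Γ : SchwartzZT n} (hΓ : Γ ≠ 0) :
    ∃ j t, Γ.conjCoeff j t ≠ 0 := by
  by_contra! h
  refine hΓ (Subtype.ext (funext fun j => funext fun x => ?_))
  have h0 : torusCoeff (fun x => conj (Γ j x)) = fun _ => 0 := funext (h j)
  have hc := Γ.continuous j
  have := hasSum_torusCoeff (f := fun x => conj (Γ j x)) (by fun_prop)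
    (by rw [h0]; exact summable_zero) x
  rw [h0] at this
  simp only [zero_mul] at this
  have h1 : conj (Γ j x) = 0 := this.unique hasSum_zero
  exact (map_eq_zero _).1 h1

/-- For a non-zero window coefficient at (j, t), the choice m = k - j, l = t - s keeps that window
factor fixed while (m, l) runs through the whole lattice once. Summing the coefficient bounds then
gives at most the M¹ norm. -/
theorem MemModulationZT.summable_coeff {Γ : SchwartzZT n} (hΓ : Γ ≠ 0) {ς : TemperedZT n}
    (hς : MemModulationZT Γ 1 ς) : Summable fun x => ‖ς.coeff x‖ := by
  obtain ⟨j, t, hjt⟩ := exists_conjCoeff_ne_zero hΓ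
  have hfin : ∫⁻ z, ‖stftZT Γ ς z‖ₑ ∂((phaseMeasure n).prod ((haarTorus n).prod Measure.count))
      < ⊤ := by
    have := (memLp_one_iff_integrable.1 hς).2
    exact this
  rw [lintegral_phase_prod _ (measurable_stftZT Γ ς).enorm] at hfin
  let e : IntLattice n × IntLattice n ≃ IntLattice n × IntLattice n :=
    (Equiv.subRight j).prodCongr (Equiv.subLeft t)
  rw [← e.tsum_eq] at hfin
  have hle : ∑' x, ‖ς.coeff x‖ₑ * ‖Γ.conjCoeff j t‖ₑ < ⊤ := by
    refine lt_of_le_of_lt (ENNReal.tsum_le_tsum fun x => ?_) hfin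
    have := enorm_coeff_mul_conjCoeff_le Γ ς x.1 x.2 (x.1 - j) (t - x.2)
    rwa [sub_sub_cancel, add_sub_cancel] at this
  rw [ENNReal.tsum_mul_right] at hle
  have h0 : ‖Γ.conjCoeff j t‖ₑ ≠ 0 := by simpa using hjt
  have h1 : ∑' x, ‖ς.coeff x‖ₑ ≠ ⊤ := fun h => by
    rw [h, ENNReal.top_mul h0] at hle; exact lt_irrefl _ hle
  exact tsum_enorm_ne_top_iff_summable_norm.1 h1

/-! ### Elements of `M¹` are functions -/

theorem lintegral_phaseMeasure (f : IntLattice n × Torus n → ℝ≥0∞) (hf : Measurable f) :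
    ∫⁻ z, f z ∂phaseMeasure n = ∑' m, ∫⁻ w, f (m, w) ∂haarTorus n := by
  rw [phaseMeasure, lintegral_prod _ hf.aemeasurable, lintegral_count]

theorem integral_phaseMeasure {f : IntLattice n × Torus n → ℂ} (hf : Integrable f (phaseMeasure n)) :
    ∫ z, f z ∂phaseMeasure n = ∑' m, ∫ w, f (m, w) ∂haarTorus n := by
  rw [phaseMeasure] at hf ⊢
  rw [integral_prod _ hf, integral_countable hf.integral_prod_left]
  simp

/-- The function with partial Fourier coefficients `ς.coeff`. -/
def TemperedZT.toFunction (ς : TemperedZT n) (z : IntLattice n × Torus n) : ℂ :=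
  ∑' s, ς.coeff (z.1, s) * UnitAddTorus.mFourier (-s) z.2

theorem TemperedZT.hasSum_toFunction {ς : TemperedZT n} (h : Summable fun x => ‖ς.coeff x‖)
    (z : IntLattice n × Torus n) :
    HasSum (fun s => ς.coeff (z.1, s) * UnitAddTorus.mFourier (-s) z.2) (ς.toFunction z) := by
  refine (Summable.of_norm ?_).hasSum
  simp only [norm_mul, norm_mFourier_apply, mul_one]
  exact h.prod_factor z.1

theorem TemperedZT.integrable_toFunction {ς : TemperedZT n} (h : Summable fun x => ‖ς.coeff x‖) :
    Integrable ς.toFunction (phaseMeasure n) := by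
  have hm : Measurable ς.toFunction := by
    refine measurable_of_hasSum (fun s => Continuous.measurable ?_) (hasSum_toFunction h)
    have h1 : Continuous fun m : IntLattice n => ς.coeff (m, s) := continuous_of_discreteTopology
    fun_prop
  refine ⟨hm.aestronglyMeasurable, ?_⟩
  rw [HasFiniteIntegral, lintegral_phaseMeasure _ hm.enorm]
  have hle (m : IntLattice n) (w : Torus n) :
      ‖ς.toFunction (m, w)‖ₑ ≤ ∑' s, ‖ς.coeff (m, s)‖ₑ := by
    refine enorm_tsum_le_tsum_enorm.trans (le_of_eq (tsum_congr fun s => ?_))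
    rw [enorm_mul]
    have : ‖UnitAddTorus.mFourier (-s) w‖ₑ = 1 := by
      rw [← ofReal_norm, norm_mFourier_apply]; simp
    rw [this, mul_one]
  calc _ ≤ ∑' m : IntLattice n, ∫⁻ _w : Torus n, ∑' s, ‖ς.coeff (m, s)‖ₑ ∂haarTorus n :=
        ENNReal.tsum_le_tsum fun m => lintegral_mono fun w => hle m w
    _ = ∑' x, ‖ς.coeff x‖ₑ := by simp [ENNReal.tsum_prod']
    _ < ⊤ := (tsum_enorm_ne_top_iff_summable_norm.2 h).lt_top

/-- Absolute summability lets the sum over s be exchanged with the torus integral; the frequency -s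
in `toFunction` is the one appearing in `torusCoeff`. -/
theorem TemperedZT.isFunction_toFunction {ς : TemperedZT n}
    (h : Summable fun x => ‖ς.coeff x‖) : ς.IsFunction ς.toFunction := by
  refine ⟨integrable_toFunction h, fun φ => ?_⟩
  obtain ⟨C, hC⟩ := φ.decay 0 0
  have hC' (k x) : ‖φ k x‖ ≤ C := by
    obtain ⟨y, rfl⟩ := toTorus_surjective x
    have := hC k y
    rwa [pow_zero, one_mul, norm_iteratedFDeriv_zero] at this
  have hφ : Measurable fun z : IntLattice n × Torus n => φ z.1 z.2 :=
    measurable_from_prod_countable_right fun k => (φ.continuous k).measurable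
  have hint : Integrable (fun z => ς.toFunction z * φ z.1 z.2) (phaseMeasure n) :=
    (integrable_toFunction h).mul_bdd (c := C) hφ.aestronglyMeasurable
      (Filter.Eventually.of_forall fun z => hC' z.1 z.2)
  have hsum := ς.hasSum_coeff φ
  rw [integral_phaseMeasure hint, ← hsum.tsum_eq, hsum.summable.tsum_prod]
  refine tsum_congr fun k => ?_
  let F : IntLattice n → Torus n → ℂ := fun s x =>
    ς.coeff (k, s) * UnitAddTorus.mFourier (-s) x * φ k x
  have hk := φ.continuous k
  have hFn (s x) : ‖F s x‖ ≤ ‖ς.coeff (k, s)‖ * C := by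
    simp only [F, norm_mul, norm_mFourier_apply, mul_one]
    gcongr; exact hC' k x
  have h1 := hasSum_integral_of_summable_integral_norm (F := F) (μ := haarTorus n)
    (fun s => integrable_of_continuous (by fun_prop)) (by
      refine Summable.of_nonneg_of_le (fun s => integral_nonneg fun x => norm_nonneg _)
        (fun s => ?_) ((h.prod_factor k).mul_right C)
      have := integral_mono_of_nonneg (μ := haarTorus n)
        (Filter.Eventually.of_forall fun x => norm_nonneg (F s x)) (integrable_const _)
        (Filter.Eventually.of_forall fun x => hFn s x)
      simpa using this)
  have h2 (x) : ∑' s, F s x = ς.toFunction (k, x) * φ k x :=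
    ((hasSum_toFunction h (k, x)).mul_right _).tsum_eq
  simp only [h2] at h1
  rw [← h1.tsum_eq]
  refine tsum_congr fun s => ?_
  simp only [F, torusCoeff, mul_assoc]
  exact (integral_const_mul _ _).symm

/-! ### The short-time Fourier transform on `ℤⁿ` -/

theorem enorm_mFourier_apply (k : IntLattice n) (w : Torus n) :
    ‖UnitAddTorus.mFourier k w‖ₑ = 1 := by
  rw [← ofReal_norm, norm_mFourier_apply]; simp

theorem hasSum_stftZ (g : SchwartzZ n) (f : TemperedZ n) (z : IntLattice n × Torus n) :
    HasSum (fun k => f.coeff k * conj (g (k - z.1)) * UnitAddTorus.mFourier (-k) z.2)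
      (stftZ g f z) := by
  have h := f.hasSum_coeff (g.conjShift z.1 z.2)
  have h1 (k) : f.coeff k * g.conjShift z.1 z.2 k =
      f.coeff k * conj (g (k - z.1)) * UnitAddTorus.mFourier (-k) z.2 := by
    change f.coeff k * conj (UnitAddTorus.mFourier k z.2 * g (k - z.1)) = _
    rw [map_mul, UnitAddTorus.mFourier_neg]
    ring
  simpa only [h1, stftZ] using h

theorem measurable_stftZ (g : SchwartzZ n) (f : TemperedZ n) : Measurable (stftZ g f) := by
  refine measurable_of_hasSum (fun k => Continuous.measurable ?_) (hasSum_stftZ g f)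
  have h1 : Continuous fun m : IntLattice n => f.coeff k * conj (g (k - m)) :=
    continuous_of_discreteTopology
  have h2 : Continuous fun z : IntLattice n × Torus n => f.coeff k * conj (g (k - z.1)) :=
    h1.comp continuous_fst
  exact h2.mul (by fun_prop)

theorem enorm_coeff_mul_le (g : SchwartzZ n) (f : TemperedZ n) (k m : IntLattice n) :
    ‖f.coeff k‖ₑ * ‖g (k - m)‖ₑ ≤ ∫⁻ w, ‖stftZ g f (m, w)‖ₑ ∂haarTorus n := by
  have h := enorm_coeff_le_lintegral (μ := haarTorus n)
    (χ := fun k w => UnitAddTorus.mFourier (-k) w) (i₀ := k)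
    (c := fun k => f.coeff k * conj (g (k - m))) (V := fun w => stftZ g f (m, w))
    (fun x => Continuous.measurable (by fun_prop)) (fun x y => norm_mFourier_apply _ _)
    (fun x hx => ?_) (fun w => hasSum_stftZ g f (m, w))
  · rwa [enorm_mul, RCLike.enorm_conj] at h
  · simp only [mFourier_mul_conj]
    rw [integral_mFourier, if_neg]
    intro h0
    exact hx (neg_injective (sub_eq_zero.1 h0))

theorem eLpNorm_rpow_toReal {α : Type*} [MeasurableSpace α] {μ : Measure α} {f : α → ℂ}
    {p : ℝ≥0∞} (hp0 : p ≠ 0) (hp : p ≠ ⊤) :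
    eLpNorm f p μ ^ p.toReal = ∫⁻ x, ‖f x‖ₑ ^ p.toReal ∂μ := by
  rw [eLpNorm_eq_lintegral_rpow_enorm_toReal hp0 hp, one_div,
    ENNReal.rpow_inv_rpow (ENNReal.toReal_pos hp0 hp).ne']

theorem rpow_lintegral_enorm_le {α : Type*} [MeasurableSpace α] {μ : Measure α}
    [IsProbabilityMeasure μ] {f : α → ℂ} (hf : Measurable f) {r : ℝ} (hr : 1 ≤ r) :
    (∫⁻ x, ‖f x‖ₑ ∂μ) ^ r ≤ ∫⁻ x, ‖f x‖ₑ ^ r ∂μ := by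
  have h := eLpNorm'_le_eLpNorm'_of_exponent_le zero_lt_one hr μ hf.aestronglyMeasurable
  simp only [eLpNorm', ENNReal.rpow_one, one_div, inv_one] at h
  have h1 := ENNReal.rpow_le_rpow h (zero_le_one.trans hr)
  rwa [ENNReal.rpow_inv_rpow (by positivity)] at h1

theorem one_le_toReal {p : ℝ≥0∞} (hp1 : 1 ≤ p) (hp : p ≠ ⊤) : 1 ≤ p.toReal := by
  simpa using ENNReal.toReal_mono hp hp1

/-- At m = k - j the window factor is the constant g(j). Jensen's inequality on the torus, of total
mass one, passes from the L¹ bound in w to the p-th power, and k is summed. -/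
theorem tsum_enorm_coeff_rpow_le {p : ℝ≥0∞} (hp1 : 1 ≤ p) (hp : p ≠ ⊤) (g : SchwartzZ n)
    (f : TemperedZ n) (j : IntLattice n) :
    ‖g j‖ₑ ^ p.toReal * ∑' k, ‖f.coeff k‖ₑ ^ p.toReal ≤
      eLpNorm (stftZ g f) p (phaseMeasure n) ^ p.toReal := by
  have hp0 : p ≠ 0 := (zero_lt_one.trans_le hp1).ne'
  have hr := one_le_toReal hp1 hp
  have hm := measurable_stftZ g f
  rw [eLpNorm_rpow_toReal hp0 hp, lintegral_phaseMeasure _ (hm.enorm.pow_const _),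
    ← (Equiv.subRight j).tsum_eq fun m => ∫⁻ w, ‖stftZ g f (m, w)‖ₑ ^ p.toReal ∂haarTorus n,
    ← ENNReal.tsum_mul_left]
  refine ENNReal.tsum_le_tsum fun k => ?_
  have h1 := enorm_coeff_mul_le g f k (k - j)
  rw [sub_sub_cancel] at h1
  have h2 := ENNReal.rpow_le_rpow h1 (zero_le_one.trans hr)
  rw [ENNReal.mul_rpow_of_nonneg _ _ (zero_le_one.trans hr), mul_comm] at h2
  exact h2.trans (rpow_lintegral_enorm_le (hm.comp measurable_prodMk_left) hr)

/-! ### `M^p(ℤⁿ) = ℓ^p(ℤⁿ)` -/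

/-- The space `ℓ^p(ℤⁿ)`. -/
abbrev EllZ (n : ℕ) (p : ℝ≥0∞) : Type := lp (fun _ : IntLattice n => ℂ) p

theorem tsum_enorm_rpow_ne_top_iff {p : ℝ≥0∞} (hp : 0 < p.toReal) {u : IntLattice n → ℂ} :
    ∑' k, ‖u k‖ₑ ^ p.toReal ≠ ⊤ ↔ Memℓp u p := by
  rw [memℓp_gen_iff hp]
  have h (k) : ‖u k‖ₑ ^ p.toReal = ‖(‖u k‖ ^ p.toReal : ℝ)‖ₑ := by
    rw [Real.enorm_of_nonneg (by positivity), ← ENNReal.ofReal_rpow_of_nonneg (norm_nonneg _) hp.le,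
      ofReal_norm]
  simp only [h]
  rw [tsum_enorm_ne_top_iff_summable_norm]
  simp only [Real.norm_of_nonneg (Real.rpow_nonneg (norm_nonneg _) _)]

theorem tsum_enorm_rpow_eq {p : ℝ≥0∞} (hp : 0 < p.toReal) (u : EllZ n p) :
    ∑' k, ‖u k‖ₑ ^ p.toReal = ENNReal.ofReal ‖u‖ ^ p.toReal := by
  have h (k) : ‖u k‖ₑ ^ p.toReal = ENNReal.ofReal (‖u k‖ ^ p.toReal) := by
    rw [← ENNReal.ofReal_rpow_of_nonneg (norm_nonneg _) hp.le, ofReal_norm]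
  simp only [h]
  rw [← ENNReal.ofReal_tsum_of_nonneg (fun k => by positivity) ((lp.memℓp u).summable hp),
    ← lp.norm_rpow_eq_tsum hp, ENNReal.ofReal_rpow_of_nonneg (lp.norm_nonneg' _) hp.le]

theorem SchwartzZ.exists_ne_zero {γ : SchwartzZ n} (hγ : γ ≠ 0) : ∃ j, γ j ≠ 0 := by
  by_contra! h
  exact hγ (Subtype.ext (funext h))

theorem memℓp_coeff {γ : SchwartzZ n} (hγ : γ ≠ 0) {p : ℝ≥0∞} (hp1 : 1 ≤ p) (hp : p ≠ ⊤)
    {f : TemperedZ n} (hf : f ∈ modulationZ γ p) : Memℓp f.coeff p := by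
  obtain ⟨j, hj⟩ := SchwartzZ.exists_ne_zero hγ
  have hr := one_le_toReal hp1 hp
  rw [← tsum_enorm_rpow_ne_top_iff (by linarith)]
  intro h
  have h1 := tsum_enorm_coeff_rpow_le hp1 hp γ f j
  have h2 : eLpNorm (stftZ γ f) p (phaseMeasure n) ^ p.toReal < ⊤ :=
    ENNReal.rpow_lt_top_of_nonneg (by linarith) (MemLp.eLpNorm_ne_top hf)
  rw [h, ENNReal.mul_top] at h1
  · exact absurd (h1.trans_lt h2) (lt_irrefl _)
  · have : ‖γ j‖ₑ ≠ 0 := by simpa using hj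
    exact (ENNReal.rpow_pos (pos_iff_ne_zero.2 this) (by simp)).ne'

theorem norm_window_mul_norm_coeff_le {γ : SchwartzZ n} {p : ℝ≥0∞} (hp1 : 1 ≤ p)
    (hp : p ≠ ⊤) {f : TemperedZ n} (hf : f ∈ modulationZ γ p) (hc : Memℓp f.coeff p)
    (j : IntLattice n) :
    ‖γ j‖ * ‖(⟨f.coeff, hc⟩ : EllZ n p)‖ ≤ (eLpNorm (stftZ γ f) p (phaseMeasure n)).toReal := by
  have hr := one_le_toReal hp1 hp
  have h1 := tsum_enorm_coeff_rpow_le hp1 hp γ f j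
  have h2 := tsum_enorm_rpow_eq (by linarith) (⟨f.coeff, hc⟩ : EllZ n p)
  change ∑' k, ‖f.coeff k‖ₑ ^ p.toReal = _ at h2
  rw [h2, ← ENNReal.mul_rpow_of_nonneg _ _ (by linarith),
    ENNReal.rpow_le_rpow_iff (by linarith)] at h1
  have h3 := ENNReal.toReal_mono (MemLp.eLpNorm_ne_top hf) h1
  rwa [ENNReal.toReal_mul, toReal_enorm, ENNReal.toReal_ofReal (lp.norm_nonneg' _)] at h3

/-- The map `f ↦ (f(k))_k` from `M^p(ℤⁿ)` to `ℓ^p(ℤⁿ)`. -/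
def ModulationZ.toEll {γ : SchwartzZ n} (hγ : γ ≠ 0) {p : ℝ≥0∞} [hp1 : Fact (1 ≤ p)]
    (hp : p ≠ ⊤) : ModulationZ γ p →L[ℂ] EllZ n p where
  toFun f := ⟨f.toTempered.coeff, memℓp_coeff hγ hp1.out hp f.2⟩
  map_add' _ _ := rfl
  map_smul' _ _ := rfl
  cont := by
    obtain ⟨j, hj⟩ := SchwartzZ.exists_ne_zero hγ
    let F : ModulationZ γ p →+ EllZ n p :=
      { toFun := fun f => ⟨f.toTempered.coeff, memℓp_coeff hγ hp1.out hp f.2⟩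
        map_zero' := rfl
        map_add' := fun _ _ => rfl }
    refine AddMonoidHomClass.continuous_of_bound F ‖γ j‖⁻¹ fun f => ?_
    rw [le_inv_mul_iff₀ (norm_pos_iff.2 hj), ModulationZ.norm_def]
    exact norm_window_mul_norm_coeff_le hp1.out hp f.2 (memℓp_coeff hγ hp1.out hp f.2) j

theorem SchwartzZ.summable_norm (φ : SchwartzZ n) : Summable fun k => ‖φ k‖ := by
  obtain ⟨C, hC⟩ := φ.decay (n + 1)
  refine Summable.of_nonneg_of_le (fun k => norm_nonneg _) (fun k => ?_)
      ((summable_inv_one_add_norm_pow n).mul_left C)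
  rw [← div_eq_mul_inv, le_div_iff₀ (by positivity), mul_comm]
  exact hC k

theorem SchwartzZ.tsum_norm_le (φ : SchwartzZ n) :
    ∑' k, ‖φ k‖ ≤ SchwartzZ.seminorm n (n + 1) φ * ∑' k : IntLattice n, ((1 + ‖k‖) ^ (n + 1))⁻¹ := by
  rw [← tsum_mul_left]
  refine φ.summable_norm.tsum_le_tsum (fun k => ?_)
    ((summable_inv_one_add_norm_pow n).mul_left _)
  rw [← div_eq_mul_inv, le_div_iff₀ (by positivity), mul_comm]
  exact φ.le_seminorm (n + 1) k

/-! ### The inclusion of ℓ^p in M^p -/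

section OfEll

variable {p : ℝ≥0∞} [hp1 : Fact (1 ≤ p)]

theorem norm_mul_schwartz_le (u : EllZ n p) (φ : SchwartzZ n) (k : IntLattice n) :
    ‖u k * φ k‖ ≤ ‖u‖ * ‖φ k‖ := by
  rw [norm_mul]
  gcongr
  exact lp.norm_apply_le_norm (zero_lt_one.trans_le hp1.out).ne' u k

theorem summable_mul_schwartz (u : EllZ n p) (φ : SchwartzZ n) : Summable fun k => u k * φ k :=
  Summable.of_norm_bounded (φ.summable_norm.mul_left ‖u‖) (norm_mul_schwartz_le u φ)

/-- The linear functional `φ ↦ ∑ u(k) φ(k)` on `𝒮(ℤⁿ)`, for `u ∈ ℓ^p(ℤⁿ)`. -/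
def ellFunctional (u : EllZ n p) : SchwartzZ n →ₗ[ℂ] ℂ where
  toFun φ := ∑' k, u k * φ k
  map_add' φ ψ := by
    rw [← (summable_mul_schwartz u φ).tsum_add (summable_mul_schwartz u ψ)]
    exact tsum_congr fun k => mul_add _ _ _
  map_smul' c φ := by
    change _ = c * _
    rw [← tsum_mul_left]
    exact tsum_congr fun k => mul_left_comm _ _ _

/-- The tempered distribution given by a sequence in `ℓ^p(ℤⁿ)`. -/
def ellTempered (u : EllZ n p) : TemperedZ n where
  toLinearMap := ellFunctional u
  cont := by
    let K : ℝ := ∑' k : IntLattice n, ((1 + ‖k‖) ^ (n + 1))⁻¹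
    have hK : 0 ≤ K := tsum_nonneg fun k => by positivity
    -- One seminorm suffices: u is bounded by ‖u‖, and with index n + 1 the reciprocal weights have
    -- finite sum K.
    refine WithSeminorms.continuous_normedSpace_rng (𝕝₂ := ℂ) ℂ (SchwartzZ.withSeminorms n) (ellFunctional u)
      ⟨{n + 1}, ⟨‖u‖ * K, by positivity⟩, fun φ => ?_⟩
    rw [Finset.sup_singleton]
    change ‖∑' k, u k * φ k‖ ≤ ‖u‖ * K * SchwartzZ.seminorm n (n + 1) φ
    have hs := φ.summable_norm.mul_left ‖u‖
    calc _ ≤ ∑' k, ‖u‖ * ‖φ k‖ := tsum_of_norm_bounded hs.hasSum (norm_mul_schwartz_le u φ)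
      _ = ‖u‖ * ∑' k, ‖φ k‖ := tsum_mul_left
      _ ≤ ‖u‖ * (SchwartzZ.seminorm n (n + 1) φ * K) := by gcongr; exact φ.tsum_norm_le
      _ = _ := by ring

theorem isFunction_ellTempered (u : EllZ n p) : (ellTempered u).IsFunction u :=
  fun φ => (summable_mul_schwartz u φ).hasSum

/-- Hölder's inequality for the measure with weights w; it is the pointwise half of Young's
inequality below. -/
theorem tsum_mul_rpow_le {ι : Type*} {r : ℝ} (hr : 1 ≤ r) (w f : ι → ℝ≥0∞) :
    (∑' i, w i * f i) ^ r ≤ (∑' i, w i) ^ (r - 1) * ∑' i, w i * f i ^ r := by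
  have hr0 : 0 < r := by linarith
  have h : ∑' i, w i * f i ≤ (∑' i, w i) ^ (1 - r⁻¹) * (∑' i, w i * f i ^ r) ^ r⁻¹ := by
    rw [ENNReal.tsum_eq_iSup_sum]
    refine iSup_le fun A => (ENNReal.inner_le_weight_mul_Lp_of_nonneg A hr w f).trans ?_
    have : 0 ≤ 1 - r⁻¹ := by
      rw [sub_nonneg]; exact inv_le_one_of_one_le₀ hr
    gcongr <;> exact ENNReal.sum_le_tsum A
  have h1 := ENNReal.rpow_le_rpow h hr0.le
  rwa [ENNReal.mul_rpow_of_nonneg _ _ hr0.le, ENNReal.rpow_inv_rpow hr0.ne', ← ENNReal.rpow_mul,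
    show (1 - r⁻¹) * r = r - 1 by field_simp] at h1

theorem enorm_stftZ_ellTempered_le (γ : SchwartzZ n) (u : EllZ n p) (z : IntLattice n × Torus n) :
    ‖stftZ γ (ellTempered u) z‖ₑ ≤ ∑' j, ‖γ j‖ₑ * ‖u (j + z.1)‖ₑ := by
  have h : stftZ γ (ellTempered u) z = ∑' k, u k * γ.conjShift z.1 z.2 k := rfl
  rw [h]
  refine enorm_tsum_le_tsum_enorm.trans (le_of_eq ?_)
  rw [← (Equiv.addRight z.1).tsum_eq]
  refine tsum_congr fun j => ?_
  change ‖u (j + z.1) * conj (UnitAddTorus.mFourier (j + z.1) z.2 * γ (j + z.1 - z.1))‖ₑ = _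
  rw [enorm_mul, RCLike.enorm_conj, enorm_mul, enorm_mFourier_apply, one_mul, add_sub_cancel_right,
    mul_comm]

/-- Uniformly in w, the transform is dominated by the correlation of |γ| ∈ ℓ¹ with |u| ∈ ℓ^p, so
this is Young's inequality; integration over w contributes mass one. -/
theorem eLpNorm_stftZ_ellTempered_le (hp : p ≠ ⊤) (γ : SchwartzZ n) (u : EllZ n p) :
    eLpNorm (stftZ γ (ellTempered u)) p (phaseMeasure n) ≤
      (∑' j, ‖γ j‖ₑ) * ENNReal.ofReal ‖u‖ := by
  have hp0 : p ≠ 0 := (zero_lt_one.trans_le hp1.out).ne'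
  have hr := one_le_toReal hp1.out hp
  have hr0 : 0 < p.toReal := by linarith
  have hm := measurable_stftZ γ (ellTempered u)
  let K : ℝ≥0∞ := ∑' j, ‖γ j‖ₑ
  rw [← ENNReal.rpow_le_rpow_iff hr0, eLpNorm_rpow_toReal hp0 hp,
    lintegral_phaseMeasure _ (hm.enorm.pow_const _)]
  calc _ ≤ ∑' m : IntLattice n, ∫⁻ _w : Torus n,
        K ^ (p.toReal - 1) * ∑' j, ‖γ j‖ₑ * ‖u (j + m)‖ₑ ^ p.toReal ∂haarTorus n := by
        refine ENNReal.tsum_le_tsum fun m => lintegral_mono fun w => ?_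
        exact (ENNReal.rpow_le_rpow (enorm_stftZ_ellTempered_le γ u (m, w)) hr0.le).trans
          (tsum_mul_rpow_le hr _ _)
    _ = K ^ (p.toReal - 1) * ∑' m, ∑' j, ‖γ j‖ₑ * ‖u (j + m)‖ₑ ^ p.toReal := by
        simp [ENNReal.tsum_mul_left]
    _ = K ^ (p.toReal - 1) * (K * ENNReal.ofReal ‖u‖ ^ p.toReal) := by
        rw [ENNReal.tsum_comm]
        have (j : IntLattice n) : ∑' m, ‖u (j + m)‖ₑ ^ p.toReal = ENNReal.ofReal ‖u‖ ^ p.toReal := by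
          rw [← tsum_enorm_rpow_eq hr0]
          exact (Equiv.addLeft j).tsum_eq fun m => ‖u m‖ₑ ^ p.toReal
        simp only [ENNReal.tsum_mul_left, this, ENNReal.tsum_mul_right, K]
    _ = _ := by
        rw [ENNReal.mul_rpow_of_nonneg _ _ hr0.le, ← mul_assoc]
        congr 1
        have := ENNReal.rpow_add_of_nonneg (x := K) (p.toReal - 1) 1 (by linarith) zero_le_one
        rw [sub_add_cancel, ENNReal.rpow_one] at this
        exact this.symm

theorem SchwartzZ.tsum_enorm_lt_top (φ : SchwartzZ n) : ∑' k, ‖φ k‖ₑ < ⊤ :=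
  (tsum_enorm_ne_top_iff_summable_norm.2 φ.summable_norm).lt_top

/-- The inclusion of `ℓ^p(ℤⁿ)` into `M^p(ℤⁿ)`. -/
def ModulationZ.ofEll (γ : SchwartzZ n) (hp : p ≠ ⊤) : EllZ n p →L[ℂ] ModulationZ γ p := by
  have hlt (u : EllZ n p) : (∑' j, ‖γ j‖ₑ) * ENNReal.ofReal ‖u‖ < ⊤ :=
    ENNReal.mul_lt_top γ.tsum_enorm_lt_top ENNReal.ofReal_lt_top
  let F : EllZ n p →ₗ[ℂ] ModulationZ γ p :=
    { toFun := fun u => ⟨ellTempered u, (measurable_stftZ γ _).aestronglyMeasurable,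
        (eLpNorm_stftZ_ellTempered_le hp γ u).trans_lt (hlt u)⟩
      map_add' := fun u v => Subtype.ext (ContinuousLinearMap.ext fun φ => by
        change ∑' k, (u k + v k) * φ k = ∑' k, u k * φ k + ∑' k, v k * φ k
        rw [← (summable_mul_schwartz u φ).tsum_add (summable_mul_schwartz v φ)]
        exact tsum_congr fun k => add_mul _ _ _)
      map_smul' := fun c u => Subtype.ext (ContinuousLinearMap.ext fun φ => by
        change ∑' k, (c * u k) * φ k = c * ∑' k, u k * φ k
        rw [← tsum_mul_left]
        exact tsum_congr fun k => mul_assoc _ _ _) }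
  refine ⟨F, AddMonoidHomClass.continuous_of_bound F (∑' j, ‖γ j‖ₑ).toReal fun u => ?_⟩
  rw [ModulationZ.norm_def]
  have := ENNReal.toReal_mono (hlt u).ne (eLpNorm_stftZ_ellTempered_le hp γ u)
  rwa [ENNReal.toReal_mul, ENNReal.toReal_ofReal (norm_nonneg _)] at this

end OfEll

theorem stronglyMeasurable_of_hasSum {ι X E : Type*} [Countable ι] [MeasurableSpace X]
    [NormedAddCommGroup E] {f : ι → X → E} {g : X → E} (hf : ∀ i, StronglyMeasurable (f i))
    (h : ∀ x, HasSum (fun i => f i x) (g x)) : StronglyMeasurable g :=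
  stronglyMeasurable_of_tendsto (f := fun (A : Finset ι) x => ∑ i ∈ A, f i x) Filter.atTop
    (fun A => Finset.stronglyMeasurable_fun_sum A fun i _ => hf i) (tendsto_pi_nhds.2 fun x => h x)

/-! ### Time-frequency shifts and the duality pairing on `ℓ^p(ℤⁿ)` -/

theorem enorm_tfShift (m : IntLattice n) (w : Torus n) (g : IntLattice n → ℂ) (k : IntLattice n) :
    ‖tfShift m w g k‖ₑ = ‖g (k - m)‖ₑ := by
  rw [tfShift, enorm_mul, enorm_mFourier_apply, one_mul]

theorem tsum_enorm_tfShift_rpow (r : ℝ) (m : IntLattice n) (w : Torus n) (g : IntLattice n → ℂ) :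
    ∑' k, ‖tfShift m w g k‖ₑ ^ r = ∑' k, ‖g k‖ₑ ^ r := by
  simp only [enorm_tfShift]
  exact (Equiv.subRight m).tsum_eq fun k => ‖g k‖ₑ ^ r

theorem continuous_tfShift (g : IntLattice n → ℂ) (k : IntLattice n) :
    Continuous fun z : IntLattice n × Torus n => tfShift z.1 z.2 g k := by
  have h : Continuous fun m : IntLattice n => g (k - m) := continuous_of_discreteTopology
  unfold tfShift
  fun_prop

section Shift

variable {p : ℝ≥0∞} [hp1 : Fact (1 ≤ p)]

/-- The time-frequency shift `M_w T_m u` of `u ∈ ℓ^p(ℤⁿ)`. -/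
def shiftEll (hp : p ≠ ⊤) (u : EllZ n p) (z : IntLattice n × Torus n) : EllZ n p :=
  ⟨tfShift z.1 z.2 u, by
    have hr : 0 < p.toReal := zero_lt_one.trans_le (one_le_toReal hp1.out hp)
    refine (tsum_enorm_rpow_ne_top_iff hr).1 ?_
    rw [tsum_enorm_tfShift_rpow]
    exact (tsum_enorm_rpow_ne_top_iff hr).2 (lp.memℓp u)⟩

theorem shiftEll_apply (hp : p ≠ ⊤) (u : EllZ n p) (z : IntLattice n × Torus n)
    (k : IntLattice n) : shiftEll hp u z k = tfShift z.1 z.2 u k := rfl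

theorem norm_shiftEll (hp : p ≠ ⊤) (u : EllZ n p) (z : IntLattice n × Torus n) :
    ‖shiftEll hp u z‖ = ‖u‖ := by
  have hr : 0 < p.toReal := zero_lt_one.trans_le (one_le_toReal hp1.out hp)
  have h := tsum_enorm_rpow_eq hr (shiftEll hp u z)
  simp only [shiftEll_apply] at h
  rw [tsum_enorm_tfShift_rpow, tsum_enorm_rpow_eq hr u] at h
  have h1 := congrArg (fun x => (x ^ p.toReal⁻¹).toReal) h
  simp only [ENNReal.rpow_rpow_inv hr.ne'] at h1
  rw [ENNReal.toReal_ofReal (norm_nonneg _), ENNReal.toReal_ofReal (norm_nonneg _)] at h1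
  exact h1.symm

/-- Since p < ∞, an element of ℓ^p is the norm-convergent sum of its coordinates, and each
coordinate of the shift is continuous in (m, w). -/
theorem stronglyMeasurable_shiftEll (hp : p ≠ ⊤) (u : EllZ n p) :
    StronglyMeasurable (shiftEll hp u) := by
  let G : IntLattice n → IntLattice n × Torus n → EllZ n p := fun k z =>
    lp.single p k (tfShift z.1 z.2 u k)
  have hG (k) : StronglyMeasurable (G k) := by
    have h1 : StronglyMeasurable fun z : IntLattice n × Torus n => tfShift z.1 z.2 u k :=
      (continuous_tfShift u k).measurable.stronglyMeasurable
    have h2 : Continuous fun c : ℂ => (lp.single p k c : EllZ n p) :=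
      (lp.singleContinuousLinearMap ℂ (fun _ : IntLattice n => ℂ) p k).continuous
    exact h2.comp_stronglyMeasurable h1
  have hs (z) : HasSum (fun k => G k z) (shiftEll hp u z) := lp.hasSum_single hp (shiftEll hp u z)
  exact stronglyMeasurable_of_hasSum hG hs

end Shift

section Pairing

variable {p q : ℝ≥0∞}

theorem summable_norm_mul_conj (hpq : p.toReal.HolderConjugate q.toReal) (h : EllZ n q)
    (f : EllZ n p) : Summable fun k => ‖f k * conj (h k)‖ := by
  simpa only [norm_mul, RCLike.norm_conj] using lp.summable_mul hpq f h

variable [hp1 : Fact (1 ≤ p)] [hq1 : Fact (1 ≤ q)]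

/-- The pairing `⟨f, h⟩ = ∑ f(k) conj (h(k))` of `ℓ^p(ℤⁿ)` and `ℓ^q(ℤⁿ)`. -/
def pairing (hpq : p.toReal.HolderConjugate q.toReal) :
    EllZ n q →L⋆[ℂ] EllZ n p →L[ℂ] ℂ :=
  LinearMap.mkContinuous₂
    (LinearMap.mk₂'ₛₗ (starRingEnd ℂ) (RingHom.id ℂ) (fun h f => ∑' k, f k * conj (h k))
      (fun h₁ h₂ f => by
        rw [← (summable_norm_mul_conj hpq h₁ f).of_norm.tsum_add
          (summable_norm_mul_conj hpq h₂ f).of_norm]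
        refine tsum_congr fun k => ?_
        change f k * conj (h₁ k + h₂ k) = _
        rw [map_add, mul_add])
      (fun c h f => by
        change _ = conj c * _
        rw [← tsum_mul_left]
        refine tsum_congr fun k => ?_
        change f k * conj (c * h k) = _
        rw [map_mul]; ring)
      (fun h f₁ f₂ => by
        rw [← (summable_norm_mul_conj hpq h f₁).of_norm.tsum_add
          (summable_norm_mul_conj hpq h f₂).of_norm]
        refine tsum_congr fun k => ?_
        change (f₁ k + f₂ k) * _ = _
        rw [add_mul])
      (fun c h f => by
        change _ = c * _
        rw [← tsum_mul_left]
        refine tsum_congr fun k => ?_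
        change (c * f k) * _ = _
        rw [mul_assoc]))
    1 (fun h f => by
      have h1 := lp.tsum_mul_le_mul_norm' hpq f h
      have h2 := norm_tsum_le_tsum_norm (summable_norm_mul_conj hpq h f)
      simp only [norm_mul, RCLike.norm_conj] at h2
      calc _ ≤ _ := h2
        _ ≤ _ := h1
        _ = _ := by ring)

end Pairing

/-! ### Integrals of compact operators -/

/-- The quotient map V → V/S is continuous and linear, so it commutes with the integral, and it
annihilates every R x. Closedness of S makes V/S a normed space. -/
theorem integral_mem_of_isClosed {X V : Type*} [MeasurableSpace X] {μ : Measure X}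
    [NormedAddCommGroup V] [NormedSpace ℂ V] [CompleteSpace V] (S : Submodule ℂ V)
    (hS : IsClosed (S : Set V)) {R : X → V} (hR : ∀ x, R x ∈ S) (hi : Integrable R μ) :
    ∫ x, R x ∂μ ∈ S := by
  have h := S.mkQL.integral_comp_comm hi
  have h0 (x) : S.mkQL (R x) = 0 := (Submodule.Quotient.mk_eq_zero S).2 (hR x)
  simp only [h0, integral_zero] at h
  exact (Submodule.Quotient.mk_eq_zero S).1 h.symm

theorem isCompactOperator_integral {X E F : Type*} [MeasurableSpace X] {μ : Measure X}
    [NormedAddCommGroup E] [NormedSpace ℂ E] [NormedAddCommGroup F] [NormedSpace ℂ F]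
    [CompleteSpace F] {R : X → E →L[ℂ] F} (hR : ∀ x, IsCompactOperator (R x))
    (hi : Integrable R μ) : IsCompactOperator (∫ x, R x ∂μ : E →L[ℂ] F) :=
  integral_mem_of_isClosed (compactOperator (RingHom.id ℂ) E F)
    isClosed_setOfPred_isCompactOperator hR hi

theorem stronglyMeasurable_smulRightL {X E F : Type*} [MeasurableSpace X]
    [NormedAddCommGroup E] [NormedSpace ℂ E] [NormedAddCommGroup F] [NormedSpace ℂ F]
    {φ : X → E →L[ℂ] ℂ} {v : X → F} (hφ : StronglyMeasurable φ) (hv : StronglyMeasurable v) :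
    StronglyMeasurable fun x => ContinuousLinearMap.smulRightL ℂ E F (φ x) (v x) :=
  (ContinuousLinearMap.smulRightL ℂ E F).continuous₂.comp_stronglyMeasurable (hφ.prodMk hv)

theorem isCompactOperator_smulRight {E F : Type*} [NormedAddCommGroup E] [NormedSpace ℂ E]
    [NormedAddCommGroup F] [NormedSpace ℂ F] (φ : E →L[ℂ] ℂ) (v : F) :
    IsCompactOperator (φ.smulRight v) := by
  have h : IsCompactOperator φ := isCompactOperator_of_locallyCompactSpace_dom φ
  exact h.clm_comp (ContinuousLinearMap.toSpanSingleton ℂ v)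

/-! ### Localization operators on `ℓ^p(ℤⁿ)` -/

section LocOp

variable {p q : ℝ≥0∞} [hp1 : Fact (1 ≤ p)] [hq1 : Fact (1 ≤ q)]

/-- The rank one operator `f ↦ V_{g₁} f(z) M_w T_m g₂`, `z = (m, w)`. -/
def rankOne (hp : p ≠ ⊤) (hq : q ≠ ⊤) (hpq : p.toReal.HolderConjugate q.toReal)
    (g₁ : EllZ n q) (g₂ : EllZ n p) (z : IntLattice n × Torus n) : EllZ n p →L[ℂ] EllZ n p :=
  ContinuousLinearMap.smulRightL ℂ (EllZ n p) (EllZ n p) (pairing hpq (shiftEll hq g₁ z))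
    (shiftEll hp g₂ z)

variable (hp : p ≠ ⊤) (hq : q ≠ ⊤) (hpq : p.toReal.HolderConjugate q.toReal)
    (g₁ : EllZ n q) (g₂ : EllZ n p)

theorem stronglyMeasurable_rankOne : StronglyMeasurable (rankOne hp hq hpq g₁ g₂) := by
  have h1 : StronglyMeasurable fun z => pairing hpq (shiftEll hq g₁ z) :=
    (pairing hpq).continuous.comp_stronglyMeasurable (stronglyMeasurable_shiftEll hq g₁)
  exact stronglyMeasurable_smulRightL h1 (stronglyMeasurable_shiftEll hp g₂)

/-- Uniformity in z comes from the shifts being isometries; it makes the product with any integrable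
symbol Bochner integrable in operator norm. -/
theorem norm_rankOne_le (z : IntLattice n × Torus n) :
    ‖rankOne hp hq hpq g₁ g₂ z‖ ≤ ‖pairing (n := n) hpq‖ * ‖g₁‖ * ‖g₂‖ := by
  have h1 := (pairing hpq).le_opNorm (shiftEll hq g₁ z)
  rw [norm_shiftEll] at h1
  calc _ = ‖pairing hpq (shiftEll hq g₁ z)‖ * ‖shiftEll hp g₂ z‖ :=
        ContinuousLinearMap.norm_smulRight_apply _ _
    _ ≤ _ := by rw [norm_shiftEll]; gcongr

theorem integrable_smul_rankOne {F : IntLattice n × Torus n → ℂ}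
    (hF : Integrable F (phaseMeasure n)) :
    Integrable (F • rankOne hp hq hpq g₁ g₂) (phaseMeasure n) :=
  hF.smul_bdd _ (stronglyMeasurable_rankOne hp hq hpq g₁ g₂).aestronglyMeasurable
    (Filter.Eventually.of_forall (norm_rankOne_le hp hq hpq g₁ g₂))

/-- Evaluation `R ↦ (R f)(k)` on operators on `ℓ^p(ℤⁿ)`. -/
def evalOp (f : EllZ n p) (k : IntLattice n) : (EllZ n p →L[ℂ] EllZ n p) →L[ℂ] ℂ :=
  (lp.evalCLM ℂ (fun _ : IntLattice n => ℂ) p k).comp (ContinuousLinearMap.apply ℂ (EllZ n p) f)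

theorem evalOp_smul_rankOne (F : IntLattice n × Torus n → ℂ) (f : EllZ n p) (k : IntLattice n)
    (z : IntLattice n × Torus n) :
    evalOp f k ((F • rankOne hp hq hpq g₁ g₂) z) = locIntegrand F g₁ g₂ f k z := by
  change F z * (stftFun g₁ f z.1 z.2 * tfShift z.1 z.2 g₂ k) = _
  rw [locIntegrand, mul_assoc]

theorem integrable_locIntegrand (hp : p ≠ ⊤) (hq : q ≠ ⊤)
    (hpq : p.toReal.HolderConjugate q.toReal) {F : IntLattice n × Torus n → ℂ}
    (hF : Integrable F (phaseMeasure n)) (f : EllZ n p) (k : IntLattice n) :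
    Integrable (locIntegrand F g₁ g₂ f k) (phaseMeasure n) := by
  have h := (evalOp f k).integrable_comp (integrable_smul_rankOne hp hq hpq g₁ g₂ hF)
  simpa only [evalOp_smul_rankOne] using h

/-- The localization operator as an operator on `ℓ^p(ℤⁿ)`. -/
def locEll (F : IntLattice n × Torus n → ℂ) : EllZ n p →L[ℂ] EllZ n p :=
  ∫ z, (F • rankOne hp hq hpq g₁ g₂) z ∂phaseMeasure n

/-- Evaluation at f and k is a continuous functional on operators, so it passes under the Bochner
integral; Fubini then splits the phase-space integral into the sum over m and the integral over w.
-/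
theorem locEll_apply {F : IntLattice n × Torus n → ℂ} (hF : Integrable F (phaseMeasure n))
    (f : EllZ n p) (k : IntLattice n) :
    locEll hp hq hpq g₁ g₂ F f k = locOp F g₁ g₂ f k := by
  have h := (evalOp f k).integral_comp_comm (integrable_smul_rankOne hp hq hpq g₁ g₂ hF)
  simp only [evalOp_smul_rankOne] at h
  rw [integral_phaseMeasure (integrable_locIntegrand g₁ g₂ hp hq hpq hF f k)] at h
  exact h.symm

theorem isCompactOperator_locEll {F : IntLattice n × Torus n → ℂ}
    (hF : Integrable F (phaseMeasure n)) : IsCompactOperator (locEll hp hq hpq g₁ g₂ F) :=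
  isCompactOperator_integral
    (fun z => (isCompactOperator_smulRight (pairing hpq (shiftEll hq g₁ z))
      (shiftEll hp g₂ z)).smul (F z))
    (integrable_smul_rankOne hp hq hpq g₁ g₂ hF)

end LocOp

end DiscreteTF

end

/-! ### Transfer from ℓ^p to M^p -/

theorem mainTheorem6 (n : ℕ) (p q : ℝ≥0∞) [Fact (1 ≤ p)] (hp : 1 < p) (hp_top : p < ⊤)
    (hpq : p.HolderConjugate q)
    (γ : SchwartzZ n) (hγ : γ ≠ 0) (Γ : SchwartzZT n) (hΓ : Γ ≠ 0)
    (ς : TemperedZT n) (hς : MemModulationZT Γ 1 ς)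
    (g₁ g₂ : TemperedZ n) (hg₁ : g₁ ∈ modulationZ γ q) (hg₂ : g₂ ∈ modulationZ γ p) :
    (∃ F : IntLattice n × Torus n → ℂ, ς.IsFunction F) ∧
    ∀ F : IntLattice n × Torus n → ℂ, ς.IsFunction F →
      (∀ f : ModulationZ γ p,
        (∀ m w, Summable fun k => f.toTempered.coeff k * conj (tfShift m w g₁.coeff k)) ∧
        (∀ k, Integrable (locIntegrand F g₁.coeff g₂.coeff f.toTempered.coeff k)
          (phaseMeasure n))) ∧
      ∃ L : ModulationZ γ p →L[ℂ] ModulationZ γ p,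
        (∀ f : ModulationZ γ p,
          (L f).toTempered.IsFunction (locOp F g₁.coeff g₂.coeff f.toTempered.coeff)) ∧
        IsCompactOperator L := by
  refine ⟨⟨ς.toFunction, TemperedZT.isFunction_toFunction (hς.summable_coeff hΓ)⟩, fun F hF => ?_⟩
  have hp' : p ≠ ⊤ := hp_top.ne
  have hpr : 1 < p.toReal := by
    simpa using (ENNReal.toReal_lt_toReal ENNReal.one_ne_top hp').2 hp
  have hr : p.toReal.HolderConjugate q.toReal := ENNReal.HolderConjugate.toReal hpr
  -- `toReal` sends ⊤ to 0, whereas a real conjugate exponent is positive.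
  have hq' : q ≠ ⊤ := fun h => by
    have := hr.symm.pos
    simp [h] at this
  have hq1 : 1 ≤ q := by
    rw [← ENNReal.ofReal_toReal hq', ← ENNReal.ofReal_one]
    exact ENNReal.ofReal_le_ofReal hr.symm.lt.le
  have : Fact (1 ≤ q) := ⟨hq1⟩
  let G₁ : EllZ n q := ⟨g₁.coeff, memℓp_coeff hγ hq1 hq' hg₁⟩
  let G₂ : EllZ n p := ⟨g₂.coeff, memℓp_coeff hγ hp.le hp' hg₂⟩
  let A := ModulationZ.toEll hγ hp'
  let T := locEll hp' hq' hr G₁ G₂ F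
  let B := ModulationZ.ofEll γ hp'
  -- The operator passes from M^p to ℓ^p by taking values, acts there by the compact `T`, and
  -- returns through the inclusion; compactness survives composition with bounded maps on either
  -- side.
  refine ⟨fun f => ⟨fun m w => ?_, fun k => ?_⟩, B.comp (T.comp A), fun f => ?_, ?_⟩
  · exact (summable_norm_mul_conj hr (shiftEll hq' G₁ (m, w)) (A f)).of_norm
  · exact integrable_locIntegrand G₁ G₂ hp' hq' hr hF.1 (A f) k
  · have h : ⇑(T (A f)) = locOp F g₁.coeff g₂.coeff f.toTempered.coeff :=
      funext fun k => locEll_apply hp' hq' hr G₁ G₂ hF.1 (A f) k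
    rw [← h]
    exact isFunction_ellTempered (T (A f))
  · exact ((isCompactOperator_locEll hp' hq' hr G₁ G₂ hF.1).comp_clm A).clm_comp B
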